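/- **Setting.** Let $N\ge 1$, $\hat\xi_1,\dots,\hat\xi_N\in\mathbb R^m$, $\epsilon\ge 0$, $\rho\in\mathbb R$, $\hat\mu=\frac1N\sum_i\hat\xi_i$, let $A\in\mathbb R^{N\times m}$ have rows $(\hat\mu-\hat\xi_i)^\top$, let $e$ be the all-ones vector, and $\mathcal C=\{x\in\mathbb R^m: \hat\mu^\top x\ge\rho+\epsilon,\ e^\top x=1,\ x\ge0\}$. Write $\chi$ for indicator functions (values $0,+\infty$), $\widetilde{\mathcal F}=\{(x,y)\in\mathbb R^m\times\mathbb R^N: y=Ax-\epsilon e\}$ and $$f(x,y)=\tfrac1{2N}e^\top y+\tfrac1{2N}\|y\|_1+\epsilon+\chi_{\mathcal C}(x)+\chi_{\widetilde{\mathcal F}}(x,y).$$ Let $\mathcal T_f=\partial f$ (convex subdifferential) and let $\mathcal S_P$ be the set of minimizers of $f$, assumed nonempty. For $\sigma_k,\gamma_k>0$ let $\mathcal M_k=\mathrm{Diag}(e;(\sigma_k/\gamma_k)e)$ on $\mathbb R^m\times\mathbb R^N$, $\|z\|_{\mathcal M}=\sqrt{\langle z,\mathcal M z\rangle}$, $\mathrm{dist}_{\mathcal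 M}(z,\mathcal S)=\inf_{s\in \mathcal S}\|z-s\|_{\mathcal M}$, and $\mathrm{dist}$ the Euclidean distance, with $\mathrm{dist}(0,\emptyset)=+\infty$. The step sizes satisfy: $\sigma_k,\gamma_k$ nondecreasing with finite limits $\sigma_\infty,\gamma_\infty$, and $\sigma_k/\gamma_k$ nonincreasing. For an iterate $z^k=(x^k,y^k)\in\mathbb R^m\times\mathbb R^N$ put $$\mathcal P_k(z^k)=\arg\min_{x,y}\Big\{f(x,y)+\tfrac1{2\sigma_k}\|(x;y)-(x^k;Ax^k-\epsilon e)\|_{\mathcal M_k}^2\Big\}.$$ The (inexact) iteration is $z^{k+1}\approx\mathcal P_k(z^k)$ from an arbitrary $z^0$, with the criteria, for all $k\ge0$, $$\text{(A)}\ \ \|z^{k+1}-\mathcal P_k(z^k)\|_{\mathcal M_k}\le\varsigma_k,\quad \varsigma_k\ge0,\ \textstyle\sum_k\varsigma_k<\infty;$$ $$\text{(B)}\ \ \|z^{k+1}-\mathcal P_k(z^k)\|_{\mathcal M_k}\le\zeta_k\|z^{k+1}-(x^k;Ax^k-\epsilon e)\|_{\mathcal M_k},\quad \zeta_k\ge0,\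 \textstyle\sum_k\zeta_k<\infty.$$ **Theorem 4.1.** (1) Let $\{z^k\}$ be any sequence satisfying (A). Then $\{z^k\}$ is bounded and converges to some $z^*=(x^*,y^*)\in\mathcal S_P$ with $0\in\mathcal T_f(z^*)$, and $z^*$ is a KKT point: there is $u\in\mathbb R^N$ with $-\frac1{2N}e-u\in\frac1{2N}\partial\|y^*\|_1$, $A^\top u\in\partial\chi_{\mathcal C}(x^*)$, $y^*=Ax^*-\epsilon e$. Moreover, for every $k\ge0$ with $y^k=Ax^k-\epsilon e$, $$\mathrm{dist}_{\mathcal M_{k+1}}(z^{k+1},\mathcal S_P)\le\mathrm{dist}_{\mathcal M_k}(z^k,\mathcal S_P)+\varsigma_k .$$ (2) For every $r$ there is a constant $\kappa>0$, depending only on $r$ and on the problem data, such that $$\mathrm{dist}(z,\mathcal S_P)\le\kappa\,\mathrm{dist}(0,\mathcal T_f(z))\quad\text{for all } z \text{ with } \mathrm{dist}(z,\mathcal S_P)\le r,$$ and such that the following holds for every sequence $\{z^k\}$ satisfying (A) and (B), with $y^k=Ax^k-\epsilon e$ for all $k\ge0$ and $r=\sum_{k}\varsigma_k+\mathrm{dist}_{\mathcal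 M_0}(z^0,\mathcal S_P)$. Let $$\tilde\mu_k=\frac1{1-\zeta_k}\left[\zeta_k+\frac{(1+\zeta_k)\kappa\lambda_{\max}(\mathcal M_k)}{\sqrt{\sigma_k^2+\kappa^2\lambda_{\max}^2(\mathcal M_k)}}\right],\qquad \lambda_\infty=\limsup_{k\to\infty}\lambda_{\max}(\mathcal M_k).$$ For every $k\ge0$ with $\zeta_k<1$, $$\mathrm{dist}_{\mathcal M_{k+1}}(z^{k+1},\mathcal S_P)\le\tilde\mu_k\,\mathrm{dist}_{\mathcal M_k}(z^k,\mathcal S_P),\qquad \mathrm{dist}(z^{k+1},\mathcal S_P)\le\frac{\tilde\mu_k}{\sqrt{\lambda_{\min}(\mathcal M_{k+1})}}\,\mathrm{dist}_{\mathcal M_k}(z^k,\mathcal S_P),$$ and $$\limsup_{k\to\infty}\tilde\mu_k=\frac{\kappa\lambda_\infty}{\sqrt{\sigma_\infty^2+\kappa^2\lambda_\infty^2}}<1 .$$ -/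

import Mathlib

open Filter Topology

noncomputable section

namespace DRMLSAD

/-! ### Convex analysis in a Euclidean space -/

/-- Indicator function of a set: `0` on the set, `+∞` outside. -/
def indicatorFn {E : Type*} (s : Set E) (z : E) : EReal :=
  open Classical in if z ∈ s then 0 else ⊤

/-- The set of minimizers, with finite value, of an extended-real-valued function. -/
def argminSet {E : Type*} (f : E → EReal) : Set E :=
  {z | f z ≠ ⊤ ∧ ∀ z', f z ≤ f z'}

/-- The convex subdifferential `∂f(z)` of `f : E → (-∞, +∞]`; it is empty where `f z = +∞`. -/
def subdiff {E : Type*} [NormedAddCommGroup E] [InnerProductSpace ℝ E] (f : E → EReal) (z : E) :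
    Set E :=
  {v | f z ≠ ⊤ ∧ ∀ z', f z + ((inner ℝ v (z' - z) : ℝ) : EReal) ≤ f z'}

/-- `‖z‖_M = √⟨z, M z⟩`. -/
def wnorm {E : Type*} [NormedAddCommGroup E] [InnerProductSpace ℝ E] (M : E →ₗ[ℝ] E) (z : E) : ℝ :=
  √(inner ℝ z (M z))

/-- `dist_M(z, S) = inf_{s ∈ S} ‖z - s‖_M`. -/
def wdist {E : Type*} [NormedAddCommGroup E] [InnerProductSpace ℝ E] (M : E →ₗ[ℝ] E) (z : E)
    (S : Set E) : ℝ :=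
  sInf ((fun s => wnorm M (z - s)) '' S)

/-- Largest eigenvalue of a self-adjoint operator. -/
def lambdaMax {E : Type*} [NormedAddCommGroup E] [InnerProductSpace ℝ E] (M : E →ₗ[ℝ] E) : ℝ :=
  sSup {c : ℝ | Module.End.HasEigenvalue M c}

/-- Smallest eigenvalue of a self-adjoint operator. -/
def lambdaMin {E : Type*} [NormedAddCommGroup E] [InnerProductSpace ℝ E] (M : E →ₗ[ℝ] E) : ℝ :=
  sInf {c : ℝ | Module.End.HasEigenvalue M c}

/-! ### The reformulated portfolio problem -/

/-- `ℝ^m × ℝ^N` with its Euclidean structure. -/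
abbrev Z (m N : ℕ) : Type := WithLp 2 (EuclideanSpace ℝ (Fin m) × EuclideanSpace ℝ (Fin N))

/-- The vector `(x; y)`. -/
def pair {m N : ℕ} (x : EuclideanSpace ℝ (Fin m)) (y : EuclideanSpace ℝ (Fin N)) : Z m N :=
  WithLp.toLp 2 (x, y)

/-- The all-ones vector `e`. -/
def ones (N : ℕ) : EuclideanSpace ℝ (Fin N) := WithLp.toLp 2 (fun _ => 1)

/-- `‖y‖₁`. -/
def l1norm {N : ℕ} (y : EuclideanSpace ℝ (Fin N)) : ℝ := ∑ i, |y i|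

/-- Data: the sample `ξ̂_1, …, ξ̂_N ∈ ℝ^m`, the radius `ε ≥ 0`, the target return `ρ`. -/
structure Problem (m N : ℕ) where
  sample : Fin N → EuclideanSpace ℝ (Fin m)
  eps : ℝ
  eps_nonneg : 0 ≤ eps
  rho : ℝ

namespace Problem

variable {m N : ℕ} (P : Problem m N)

/-- The sample mean `μ̂ = (1/N) ∑ ξ̂_i`. -/
def mean : EuclideanSpace ℝ (Fin m) := (1 / (N : ℝ)) • ∑ i, P.sample i

/-- The `N × m` matrix with rows `μ̂ - ξ̂_i`. -/
def A : Matrix (Fin N) (Fin m) ℝ := Matrix.of fun i j => P.mean j - P.sample i j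

/-- `x ↦ A x - ε e`. -/
def aff (x : EuclideanSpace ℝ (Fin m)) : EuclideanSpace ℝ (Fin N) :=
  Matrix.toEuclideanLin P.A x - P.eps • ones N

/-- `C = {x | μ̂ᵀ x ≥ ρ + ε, x ≥ 0, eᵀ x = 1}`. -/
def C : Set (EuclideanSpace ℝ (Fin m)) :=
  {x | P.rho + P.eps ≤ inner ℝ P.mean x ∧ (∀ j, 0 ≤ x j) ∧ ∑ j, x j = 1}

/-- The affine set `{(x, y) | y = A x - ε e}`. -/
def feas : Set (Z m N) := {z | z.snd = P.aff z.fst}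

/-- `f(x,y) = eᵀy/(2N) + ‖y‖₁/(2N) + ε + χ_C(x) + χ_{y = Ax - εe}(x,y)`. -/
def f (z : Z m N) : EReal :=
  ((1 / (2 * (N : ℝ)) * ∑ i, z.snd i + 1 / (2 * (N : ℝ)) * l1norm z.snd + P.eps : ℝ) : EReal)
    + indicatorFn P.C z.fst + indicatorFn P.feas z

/-- The set of optimal solutions `(x, y)` of the reformulated problem. -/
def solutions : Set (Z m N) := argminSet P.f

/-- The maximal monotone operator `T_f = ∂f`. -/
def T (z : Z m N) : Set (Z m N) := subdiff P.f z

/-- The KKT system at `(x, y)` with multiplier `u`. -/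
def KKT (z : Z m N) (u : EuclideanSpace ℝ (Fin N)) : Prop :=
  (∃ v ∈ subdiff (fun y : EuclideanSpace ℝ (Fin N) => ((l1norm y : ℝ) : EReal)) z.snd,
      -((1 / (2 * (N : ℝ))) • ones N) - u = (1 / (2 * (N : ℝ))) • v) ∧
    Matrix.toEuclideanLin P.A.transpose u ∈ subdiff (indicatorFn P.C) z.fst ∧
    z.snd = P.aff z.fst

/-- The error bound: `dist(z, S) ≤ κ dist(0, T_f(z))` whenever `dist(z, S) ≤ r`
(with `dist(0, ∅) = +∞`). -/
def ErrorBound (r κ : ℝ) : Prop :=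
  ∀ z : Z m N, Metric.infDist z P.solutions ≤ r →
    ENNReal.ofReal (Metric.infDist z P.solutions) ≤
      ENNReal.ofReal κ * Metric.infEDist (0 : Z m N) (P.T z)

end Problem

/-! ### The preconditioned proximal point iteration -/

/-- The preconditioner `Diag(e; t e)` on `ℝ^m × ℝ^N`; the algorithm uses `t = σ_k / γ_k`. -/
def precond (m N : ℕ) (t : ℝ) : Z m N →ₗ[ℝ] Z m N where
  toFun z := pair z.fst (t • z.snd)
  map_add' z w := by simp [pair, smul_add]; rfl
  map_smul' c z := by simp [pair, smul_comm t c]; rfl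

namespace Problem

variable {m N : ℕ} (P : Problem m N)

/-- The proximal centre `(x; A x - ε e)` belonging to the iterate `(x; y)`. -/
def center (z : Z m N) : Z m N := pair z.fst (P.aff z.fst)

/-- The subproblem objective
`f(z) + (1/(2σ)) ‖z - (x^k; A x^k - ε e)‖²_M` with `M = Diag(e; (σ/γ) e)`, that is
`f(x,y) + (1/(2σ)) ‖x - x^k‖² + (1/(2γ)) ‖y - (A x^k - ε e)‖²`. -/
def subObj (σ γ : ℝ) (zk z : Z m N) : EReal :=
  P.f z + ((1 / (2 * σ) * wnorm (precond m N (σ / γ)) (z - P.center zk) ^ 2 : ℝ) : EReal)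

/-- Exact subproblem solutions `𝒫_k(z^k)`: a singleton, when `C ≠ ∅` and `σ, γ > 0`. -/
def prox (σ γ : ℝ) (zk : Z m N) : Set (Z m N) := argminSet (P.subObj σ γ zk)

/-- Criterion (A) for the whole run: `‖z^{k+1} - 𝒫_k(z^k)‖_{M_k} ≤ ς_k`. -/
def CriterionA (σ γ ς : ℕ → ℝ) (z : ℕ → Z m N) : Prop :=
  ∀ k, ∃ p ∈ P.prox (σ k) (γ k) (z k), wnorm (precond m N (σ k / γ k)) (z (k + 1) - p) ≤ ς k

/-- Criterion (B) for the whole run: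
`‖z^{k+1} - 𝒫_k(z^k)‖_{M_k} ≤ ζ_k ‖z^{k+1} - (x^k; A x^k - ε e)‖_{M_k}`. -/
def CriterionB (σ γ ζ : ℕ → ℝ) (z : ℕ → Z m N) : Prop :=
  ∀ k, ∃ p ∈ P.prox (σ k) (γ k) (z k), wnorm (precond m N (σ k / γ k)) (z (k + 1) - p) ≤
    ζ k * wnorm (precond m N (σ k / γ k)) (z (k + 1) - P.center (z k))

end Problem

/-- Step sizes: `σ_k, γ_k > 0`, `σ_k ↑ σ_∞ < ∞`, `γ_k ↑ γ_∞ < ∞`, and `σ_k / γ_k` nonincreasing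
(so that `σ_k / γ_k ↓ σ_∞ / γ_∞ > 0`). -/
structure StepSizes (σ γ : ℕ → ℝ) (σ_inf γ_inf : ℝ) : Prop where
  sigma_pos : ∀ k, 0 < σ k
  gamma_pos : ∀ k, 0 < γ k
  sigma_mono : Monotone σ
  gamma_mono : Monotone γ
  sigma_lim : Tendsto σ atTop (𝓝 σ_inf)
  gamma_lim : Tendsto γ atTop (𝓝 γ_inf)
  ratio_anti : Antitone fun k => σ k / γ k

/-- `μ̃ = (1/(1-ζ)) [ζ + (1+ζ) κ λ / √(σ² + κ² λ²)]` with `λ = λ_max(M)`. -/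
def rateFactor (κ σ ζ lam : ℝ) : ℝ :=
  1 / (1 - ζ) * (ζ + (1 + ζ) * κ * lam / √(σ ^ 2 + κ ^ 2 * lam ^ 2))

end DRMLSAD

end

/-!
The function `f` is polyhedral with compact effective domain, the graph of an affine map over a
polytope in the unit simplex, and this makes both parts of the theorem elementary.

Convergence. Convexity gives the three-point inequality `Problem.prox_three_point` for an exact
proximal step `p` from the centre `c`: for every solution `s`,
`2σ (f p - f s) + ‖p - c‖² + ‖p - s‖² ≤ ‖c - s‖²` in the weighted norm. The weights decrease, and
passing from an iterate to the next centre is uniformly Lipschitz, so the distances of the centres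
to `s` increase by at most summable amounts and converge. Hence `f p` tends to the minimum, a
cluster point of the exact steps is a solution, and the convergence of the distances to it turns the
cluster point into a limit (`Problem.exists_tendsto_of_criterionA`). The multiplier of the KKT
system comes from a Hahn-Banach separation (`Problem.exists_subgradient_loss`).

Rate. The solution set is a polyhedron, so Hoffman's bound
(`exists_infDist_le_mul_of_violation_le`) shows that the minimizers are weakly sharp:
`dist(z, S) ≤ L (f z - min f)` on the effective domain. For a subgradient `v` at `z` this yields
`dist(z, S) ≤ L ‖v‖ dist(z, S)`, hence `1 ≤ L ‖v‖` unless `z` is a solution, and since the effective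
domain is bounded, `dist(z, S) ≤ κ ‖v‖` with a constant that does not depend on the radius `r`
(`Problem.exists_infDist_le_mul_norm_subgradient`). The proximal step provides the subgradient
`M (c - p) / σ`; inserted in the three-point inequality it gives a contraction of the weighted
distance (`Problem.wdist_prox_le`), and the relative error criterion turns its factor into
`rateFactor` (`Problem.wdist_inexact_le`).
-/

namespace DRMLSAD

/-! ### Hoffman's error bound -/

/-- Hoffman's bound for a system of linear equations and inequalities. If it failed, there would be
points `z n` whose distance to the polyhedron exceeds `n + 1` times their violation; let `p n` be
their projections and `e` a limit of the unit directions from `p n` to `z n`. The constraints active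
at `p n` do not increase along `e`, so a short step from `p n` along `e` stays in the polyhedron and
approaches `z n`, which contradicts the choice of `p n`. An ultrafilter limit avoids passing to
subsequences on which the set of active constraints is constant. -/
theorem exists_infDist_le_mul_of_violation_le {E F ι : Type*} [NormedAddCommGroup E]
    [InnerProductSpace ℝ E] [FiniteDimensional ℝ E] [NormedAddCommGroup F] [NormedSpace ℝ F]
    [Finite ι] (Λ : E →ₗ[ℝ] F) (c : F) (l : ι → E →ₗ[ℝ] ℝ) (b : ι → ℝ)
    (hne : {x | Λ x = c ∧ ∀ i, l i x ≤ b i}.Nonempty) :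
    ∃ L : ℝ, 0 < L ∧ ∀ z τ, 0 ≤ τ → Λ z = c → (∀ i, l i z ≤ b i + τ) →
      Metric.infDist z {x | Λ x = c ∧ ∀ i, l i x ≤ b i} ≤ L * τ := by
  set Q : Set E := {x | Λ x = c ∧ ∀ i, l i x ≤ b i} with hQ
  have hΛ : Continuous Λ := Λ.continuous_of_finiteDimensional
  have hl : ∀ i, Continuous (l i) := fun i => (l i).continuous_of_finiteDimensional
  have hQc : IsClosed Q := by
    rw [hQ, Set.ofPred_and, Set.ofPred_forall]
    exact (isClosed_eq hΛ continuous_const).inter <|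
      isClosed_iInter fun i => isClosed_le (hl i) continuous_const
  by_contra! hcon
  choose z τ hτ hz hviol hbig using fun n : ℕ => hcon (n + 1) (by positivity)
  choose p hpQ hpz using fun n => hQc.exists_infDist_eq_dist hne (z n)
  have hpos : ∀ n, 0 < ‖z n - p n‖ := fun n => by
    rw [← dist_eq_norm, ← hpz]
    exact lt_of_le_of_lt (mul_nonneg (by positivity) (hτ n)) (hbig n)
  set d : ℕ → E := fun n => ‖z n - p n‖⁻¹ • (z n - p n) with hd
  have hd1 : ∀ n, d n ∈ Metric.sphere (0 : E) 1 := fun n => by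
    simp [hd, norm_smul, (hpos n).ne']
  have hzd : ∀ n, z n - p n = ‖z n - p n‖ • d n := fun n => by
    simp [hd, smul_smul, (hpos n).ne']
  set U : Ultrafilter ℕ := hyperfilter ℕ
  have hU : (U : Filter ℕ) ≤ atTop := by
    rw [← Nat.cofinite_eq_atTop]; exact hyperfilter_le_cofinite
  obtain ⟨e, he, hlim⟩ := (isCompact_sphere (0 : E) 1).ultrafilter_le_nhds (U.map d)
    (le_principal_iff.2 (show ∀ᶠ n in (U : Filter ℕ), d n ∈ _ from Filter.Eventually.of_forall hd1))
  have hlim : Tendsto d U (𝓝 e) := hlim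
  -- Constraints active at `p n` for `U`-most `n` are nonincreasing in the limit direction.
  have hact : ∀ i, (∀ᶠ n in (U : Filter ℕ), l i (p n) = b i) → l i e ≤ 0 := by
    intro i hi
    refine le_of_tendsto_of_tendsto (((hl i).tendsto e).comp hlim)
      (tendsto_one_div_add_atTop_nhds_zero_nat.mono_left hU) ?_
    filter_upwards [hi] with n hn
    have h1 : l i (z n - p n) ≤ τ n := by
      rw [map_sub, hn]; linarith [hviol n i]
    rw [hzd, map_smul, smul_eq_mul] at h1
    have h2 : ((n : ℝ) + 1) * τ n < ‖z n - p n‖ := by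
      rw [← dist_eq_norm, ← hpz]; exact hbig n
    have h3 : (0 : ℝ) < n + 1 := by positivity
    have h4 : ‖z n - p n‖ * (((n : ℝ) + 1) * l i (d n)) ≤ ‖z n - p n‖ * 1 := by nlinarith
    have h5 := le_of_mul_le_mul_left h4 (hpos n)
    simp only [Function.comp_apply]
    rw [le_div_iff₀ h3]; linarith
  have hker : Λ e = 0 := by
    refine tendsto_nhds_unique ((hΛ.tendsto e).comp hlim) ?_
    have h0 : ∀ n, Λ (d n) = 0 := fun n => by simp [hd, hz n, (hpQ n).1]
    simp only [Function.comp_def, h0]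
    exact tendsto_const_nhds
  have hinner : ∀ᶠ n in (U : Filter ℕ), (0 : ℝ) < inner ℝ (d n) e := by
    have h1 : Tendsto (fun n => inner ℝ (d n) e) U (𝓝 (inner ℝ e e)) :=
      hlim.inner tendsto_const_nhds
    refine h1.eventually (lt_mem_nhds ?_)
    rw [real_inner_self_eq_norm_sq]
    simp at he; simp [he]
  have hinact : ∀ᶠ n in (U : Filter ℕ), ∀ i, l i e ≤ 0 ∨ l i (p n) < b i := by
    rw [eventually_all]
    intro i
    by_cases h : ∀ᶠ n in (U : Filter ℕ), l i (p n) = b i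
    · exact Filter.Eventually.of_forall fun n => Or.inl (hact i h)
    · rw [← Ultrafilter.eventually_not] at h
      filter_upwards [h] with n hn
      exact Or.inr (lt_of_le_of_ne ((hpQ n).2 i) hn)
  obtain ⟨n, hn1, hn2⟩ := (hinner.and hinact).exists
  -- Moving from `p n` a short way along `e` stays in `Q` and gets closer to `z n`.
  have hfeas : ∀ᶠ δ in 𝓝[>] (0 : ℝ), p n + δ • e ∈ Q := by
    simp only [hQ, Set.mem_ofPred_eq, map_add, map_smul, hker, (hpQ n).1, smul_zero, add_zero,
      true_and]
    rw [eventually_all]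
    intro i
    rcases hn2 i with h | h
    · filter_upwards [self_mem_nhdsWithin] with δ hδ
      have hδ : 0 < δ := hδ
      have := (hpQ n).2 i
      simp only [smul_eq_mul]
      nlinarith
    · have h1 : Tendsto (fun δ : ℝ => l i (p n + δ • e)) (𝓝 0) (𝓝 (l i (p n + (0 : ℝ) • e))) := by
        have : Continuous fun δ : ℝ => l i (p n + δ • e) := (hl i).comp (by fun_prop)
        exact this.tendsto 0
      simp only [zero_smul, add_zero, map_add, map_smul] at h1
      exact ((h1.mono_left nhdsWithin_le_nhds).eventually (gt_mem_nhds h)).mono fun _ h => h.le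
  have hpos' : (0 : ℝ) < inner ℝ (z n - p n) e := by
    rw [hzd, real_inner_smul_left]; exact mul_pos (hpos n) hn1
  have hsmall : ∀ᶠ δ in 𝓝[>] (0 : ℝ), δ < 2 * inner ℝ (z n - p n) e :=
    (gt_mem_nhds (by linarith)).filter_mono nhdsWithin_le_nhds
  obtain ⟨δ, ⟨hδQ, hδs⟩, hδ⟩ := ((hfeas.and hsmall).and self_mem_nhdsWithin).exists
  have hδ : 0 < δ := hδ
  have h1 : ‖z n - p n‖ ≤ ‖z n - (p n + δ • e)‖ := by
    rw [← dist_eq_norm, ← dist_eq_norm, ← hpz]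
    exact Metric.infDist_le_dist_of_mem hδQ
  have h2 : ‖z n - (p n + δ • e)‖ ^ 2 =
      ‖z n - p n‖ ^ 2 - 2 * (δ * inner ℝ (z n - p n) e) + δ ^ 2 := by
    rw [← sub_sub, norm_sub_sq_real, real_inner_smul_right, norm_smul]
    simp at he
    rw [he, Real.norm_of_nonneg hδ.le]; ring
  have h3 : ‖z n - p n‖ ^ 2 ≤ ‖z n - (p n + δ • e)‖ ^ 2 := by gcongr
  nlinarith

/-! ### Extended-real functions that are finite exactly on a set -/

section EReal

variable {E : Type*} {g : E → EReal} {D : Set E} {h : E → ℝ}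

theorem mem_argminSet_iff (hD : ∀ z ∈ D, g z = h z) (hn : ∀ z, z ∉ D → g z = ⊤) {z : E} :
    z ∈ argminSet g ↔ z ∈ D ∧ ∀ z' ∈ D, h z ≤ h z' := by
  constructor
  · rintro ⟨h1, h2⟩
    have hz : z ∈ D := by
      by_contra hz; exact h1 (hn z hz)
    refine ⟨hz, fun z' hz' => ?_⟩
    have := h2 z'
    rw [hD z hz, hD z' hz'] at this
    exact_mod_cast this
  · rintro ⟨hz, h2⟩
    refine ⟨by rw [hD z hz]; exact EReal.coe_ne_top _, fun z' => ?_⟩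
    by_cases hz' : z' ∈ D
    · rw [hD z hz, hD z' hz']; exact_mod_cast h2 z' hz'
    · rw [hn z' hz']; exact le_top

theorem mem_subdiff_iff [NormedAddCommGroup E] [InnerProductSpace ℝ E]
    (hD : ∀ z ∈ D, g z = h z) (hn : ∀ z, z ∉ D → g z = ⊤) {z v : E} :
    v ∈ subdiff g z ↔ z ∈ D ∧ ∀ z' ∈ D, h z + inner ℝ v (z' - z) ≤ h z' := by
  constructor
  · rintro ⟨h1, h2⟩
    have hz : z ∈ D := by
      by_contra hz; exact h1 (hn z hz)
    refine ⟨hz, fun z' hz' => ?_⟩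
    have := h2 z'
    rw [hD z hz, hD z' hz', ← EReal.coe_add] at this
    exact_mod_cast this
  · rintro ⟨hz, h2⟩
    refine ⟨by rw [hD z hz]; exact EReal.coe_ne_top _, fun z' => ?_⟩
    by_cases hz' : z' ∈ D
    · rw [hD z hz, hD z' hz', ← EReal.coe_add]; exact_mod_cast h2 z' hz'
    · rw [hn z' hz']; exact le_top

theorem mem_subdiff_indicatorFn_iff [NormedAddCommGroup E] [InnerProductSpace ℝ E] {z v : E} :
    v ∈ subdiff (indicatorFn D) z ↔ z ∈ D ∧ ∀ z' ∈ D, inner ℝ v (z' - z) ≤ 0 := by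
  rw [mem_subdiff_iff (D := D) (h := fun _ => 0) (fun z hz => by simp [indicatorFn, hz])
    (fun z hz => by simp [indicatorFn, hz])]
  simp

end EReal

/-! ### The preconditioned norms -/

section Precond

variable {m N : ℕ}

@[simp] theorem precond_fst (t : ℝ) (z : Z m N) : (precond m N t z).fst = z.fst := rfl

@[simp] theorem precond_snd (t : ℝ) (z : Z m N) : (precond m N t z).snd = t • z.snd := rfl

theorem norm_sq_eq (z : Z m N) : ‖z‖ ^ 2 = ‖z.fst‖ ^ 2 + ‖z.snd‖ ^ 2 :=
  WithLp.prod_norm_sq_eq_of_L2 z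

theorem ext_fst_snd {z w : Z m N} (h1 : z.fst = w.fst) (h2 : z.snd = w.snd) : z = w := by
  apply WithLp.ofLp_injective
  exact Prod.ext h1 h2

theorem precond_sqrt_sqrt {t : ℝ} (ht : 0 ≤ t) (z : Z m N) :
    precond m N (√t) (precond m N (√t) z) = precond m N t z :=
  ext_fst_snd rfl (by simp [smul_smul, Real.mul_self_sqrt ht])

theorem inner_precond_left (t : ℝ) (z w : Z m N) :
    inner ℝ (precond m N t z) w = inner ℝ z (precond m N t w) := by
  simp [WithLp.prod_inner_apply, real_inner_smul_left, real_inner_smul_right]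

/-- The weighted norm is the Euclidean norm after applying the square root of the weight. -/
theorem wnorm_precond {t : ℝ} (ht : 0 ≤ t) (z : Z m N) :
    wnorm (precond m N t) z = ‖precond m N (√t) z‖ := by
  rw [wnorm, ← precond_sqrt_sqrt ht, ← inner_precond_left, real_inner_self_eq_norm_sq,
    Real.sqrt_sq (norm_nonneg _)]

theorem norm_precond_sqrt_sq {t : ℝ} (ht : 0 ≤ t) (z : Z m N) :
    ‖precond m N (√t) z‖ ^ 2 = ‖z.fst‖ ^ 2 + t * ‖z.snd‖ ^ 2 := by
  rw [norm_sq_eq, precond_fst, precond_snd, norm_smul, mul_pow, Real.norm_eq_abs, sq_abs,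
    Real.sq_sqrt ht]

theorem wnorm_sq {t : ℝ} (ht : 0 ≤ t) (z : Z m N) :
    wnorm (precond m N t) z ^ 2 = ‖z.fst‖ ^ 2 + t * ‖z.snd‖ ^ 2 := by
  rw [wnorm_precond ht, norm_precond_sqrt_sq ht]

theorem wnorm_nonneg {E : Type*} [NormedAddCommGroup E] [InnerProductSpace ℝ E]
    (M : E →ₗ[ℝ] E) (z : E) : 0 ≤ wnorm M z := Real.sqrt_nonneg _

theorem wnorm_sub_le {t : ℝ} (ht : 0 ≤ t) (a b c : Z m N) :
    wnorm (precond m N t) (a - c) ≤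
      wnorm (precond m N t) (a - b) + wnorm (precond m N t) (b - c) := by
  simp only [wnorm_precond ht, map_sub]
  exact norm_sub_le_norm_sub_add_norm_sub _ _ _

theorem wnorm_sub_comm {t : ℝ} (ht : 0 ≤ t) (a b : Z m N) :
    wnorm (precond m N t) (a - b) = wnorm (precond m N t) (b - a) := by
  simp only [wnorm_precond ht, map_sub]
  exact norm_sub_rev _ _

theorem wnorm_mono {s t : ℝ} (hs : 0 ≤ s) (hst : s ≤ t) (z : Z m N) :
    wnorm (precond m N s) z ≤ wnorm (precond m N t) z := by
  refine le_of_sq_le_sq ?_ (wnorm_nonneg _ _)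
  rw [wnorm_sq hs, wnorm_sq (hs.trans hst)]
  gcongr

theorem wnorm_le_sqrt_max {t : ℝ} (ht : 0 ≤ t) (z : Z m N) :
    wnorm (precond m N t) z ≤ √(max 1 t) * ‖z‖ := by
  refine le_of_sq_le_sq ?_ (by positivity)
  rw [wnorm_sq ht, mul_pow, Real.sq_sqrt (by positivity), norm_sq_eq]
  nlinarith [le_max_left 1 t, le_max_right 1 t, sq_nonneg ‖z.fst‖, sq_nonneg ‖z.snd‖]

theorem sqrt_min_mul_norm_le_wnorm {t : ℝ} (ht : 0 ≤ t) (z : Z m N) :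
    √(min 1 t) * ‖z‖ ≤ wnorm (precond m N t) z := by
  refine le_of_sq_le_sq ?_ (wnorm_nonneg _ _)
  rw [wnorm_sq ht, mul_pow, Real.sq_sqrt (by positivity), norm_sq_eq]
  nlinarith [min_le_left 1 t, min_le_right 1 t, sq_nonneg ‖z.fst‖, sq_nonneg ‖z.snd‖]

theorem norm_precond_le {t : ℝ} (ht : 0 ≤ t) (z : Z m N) :
    ‖precond m N t z‖ ≤ √(max 1 t) * wnorm (precond m N t) z := by
  rw [← precond_sqrt_sqrt ht, ← wnorm_precond ht, wnorm_precond ht z]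
  exact wnorm_le_sqrt_max ht _

theorem continuous_wnorm {t : ℝ} (ht : 0 ≤ t) : Continuous (wnorm (precond m N t)) := by
  have h : wnorm (precond m N t) = fun z : Z m N => √(‖z.fst‖ ^ 2 + t * ‖z.snd‖ ^ 2) := by
    funext z
    rw [← wnorm_sq ht, Real.sqrt_sq (wnorm_nonneg _ _)]
  rw [h]
  have h1 : Continuous fun z : Z m N => z.fst := by fun_prop
  have h2 : Continuous fun z : Z m N => z.snd := by fun_prop
  fun_prop

theorem hasEigenvalue_precond_iff (hm : 0 < m) (hN : 0 < N) {t c : ℝ} :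
    Module.End.HasEigenvalue (precond m N t) c ↔ c = 1 ∨ c = t := by
  have : Nonempty (Fin m) := ⟨⟨0, hm⟩⟩
  have : Nonempty (Fin N) := ⟨⟨0, hN⟩⟩
  constructor
  · intro h
    obtain ⟨v, hv⟩ := h.exists_hasEigenvector
    have hv1 := hv.apply_eq_smul
    have h1 : v.fst = c • v.fst := congrArg (fun z : Z m N => z.fst) hv1
    have h2 : t • v.snd = c • v.snd := congrArg (fun z : Z m N => z.snd) hv1
    by_contra! hc
    refine hv.2 (ext_fst_snd ?_ ?_)
    · have : (1 - c) • v.fst = 0 := by rw [sub_smul, one_smul, ← h1, sub_self]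
      exact (smul_eq_zero.1 this).resolve_left (sub_ne_zero.2 hc.1.symm)
    · have : (t - c) • v.snd = 0 := by rw [sub_smul, h2, sub_self]
      exact (smul_eq_zero.1 this).resolve_left (sub_ne_zero.2 hc.2.symm)
  · obtain ⟨x, hx⟩ := exists_ne (0 : EuclideanSpace ℝ (Fin m))
    obtain ⟨y, hy⟩ := exists_ne (0 : EuclideanSpace ℝ (Fin N))
    rintro (rfl | rfl)
    · refine Module.End.hasEigenvalue_of_hasEigenvector (x := pair x 0) ⟨?_, ?_⟩
      · rw [Module.End.mem_eigenspace_iff]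
        exact ext_fst_snd (by simp [pair]) (by simp [pair])
      · intro h; exact hx (congrArg (fun z : Z m N => z.fst) h)
    · refine Module.End.hasEigenvalue_of_hasEigenvector (x := pair 0 y) ⟨?_, ?_⟩
      · rw [Module.End.mem_eigenspace_iff]
        exact ext_fst_snd (by simp [pair]) (by simp [pair])
      · intro h; exact hy (congrArg (fun z : Z m N => z.snd) h)

theorem lambdaMax_precond (hm : 0 < m) (hN : 0 < N) (t : ℝ) :
    lambdaMax (precond m N t) = max 1 t := by
  have : {c : ℝ | Module.End.HasEigenvalue (precond m N t) c} = {1, t} := by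
    ext c; exact hasEigenvalue_precond_iff hm hN
  rw [lambdaMax, this, csSup_pair]

theorem lambdaMin_precond (hm : 0 < m) (hN : 0 < N) (t : ℝ) :
    lambdaMin (precond m N t) = min 1 t := by
  have : {c : ℝ | Module.End.HasEigenvalue (precond m N t) c} = {1, t} := by
    ext c; exact hasEigenvalue_precond_iff hm hN
  rw [lambdaMin, this, csInf_pair]

theorem wdist_le {M : Z m N →ₗ[ℝ] Z m N} {S : Set (Z m N)} {s : Z m N} (hs : s ∈ S) (z : Z m N) :
    wdist M z S ≤ wnorm M (z - s) :=
  csInf_le ⟨0, by rintro _ ⟨_, _, rfl⟩; exact wnorm_nonneg _ _⟩ ⟨s, hs, rfl⟩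

theorem wdist_nonneg (M : Z m N →ₗ[ℝ] Z m N) (z : Z m N) (S : Set (Z m N)) : 0 ≤ wdist M z S :=
  Real.sInf_nonneg (by rintro _ ⟨_, _, rfl⟩; exact wnorm_nonneg _ _)

theorem exists_wdist_eq {S : Set (Z m N)} (hS : IsCompact S) (hne : S.Nonempty) {t : ℝ}
    (ht : 0 ≤ t) (z : Z m N) :
    ∃ s ∈ S, wdist (precond m N t) z S = wnorm (precond m N t) (z - s) := by
  have hc : Continuous fun s : Z m N => wnorm (precond m N t) (z - s) :=
    (continuous_wnorm ht).comp (by fun_prop)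
  obtain ⟨s, hs, h⟩ := hS.exists_sInf_image_eq hne hc.continuousOn
  exact ⟨s, hs, h⟩

end Precond

/-! ### The loss as a function of the residual vector -/

/-- The real-valued loss `eᵀy/(2N) + ‖y‖₁/(2N)`, which equals `(1/N) ∑ max(y_i, 0)`. -/
noncomputable def loss {N : ℕ} (y : EuclideanSpace ℝ (Fin N)) : ℝ :=
  1 / (2 * (N : ℝ)) * ∑ i, y i + 1 / (2 * (N : ℝ)) * l1norm y

theorem convexOn_l1norm {N : ℕ} : ConvexOn ℝ Set.univ (l1norm (N := N)) := by
  refine ⟨convex_univ, fun x _ y _ a b ha hb _ => ?_⟩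
  simp only [l1norm, smul_eq_mul, Finset.mul_sum, ← Finset.sum_add_distrib]
  refine Finset.sum_le_sum fun i _ => ?_
  simp only [PiLp.add_apply, PiLp.smul_apply, smul_eq_mul]
  calc |a * x i + b * y i| ≤ |a * x i| + |b * y i| := abs_add_le _ _
    _ = a * |x i| + b * |y i| := by rw [abs_mul, abs_mul, abs_of_nonneg ha, abs_of_nonneg hb]

theorem convexOn_loss {N : ℕ} : ConvexOn ℝ Set.univ (loss (N := N)) := by
  refine ⟨convex_univ, fun x hx y hy a b ha hb hab => ?_⟩
  have h := (convexOn_l1norm (N := N)).2 hx hy ha hb hab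
  have h2 : ∑ i, (a • x + b • y) i = a * ∑ i, x i + b * ∑ i, y i := by
    simp [Finset.sum_add_distrib, Finset.mul_sum]
  have hN : (0 : ℝ) ≤ 1 / (2 * (N : ℝ)) := by positivity
  have h3 := mul_le_mul_of_nonneg_left h hN
  simp only [loss, smul_eq_mul, h2] at *
  linarith

theorem continuous_loss {N : ℕ} : Continuous (loss (N := N)) := by
  unfold loss l1norm
  fun_prop

/-- The loss is the maximum over index sets `s` of the linear functions `(1/N) ∑ i ∈ s, y i`. -/
theorem loss_le_iff {N : ℕ} (hN : 0 < N) {y : EuclideanSpace ℝ (Fin N)} {c : ℝ} :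
    loss y ≤ c ↔ ∀ s : Finset (Fin N), ∑ i ∈ s, y i ≤ N * c := by
  have hN' : (0 : ℝ) < N := by exact_mod_cast hN
  have hloss : N * loss y = ∑ i, max (y i) 0 := by
    have : ∀ i, max (y i) 0 = 1 / 2 * y i + 1 / 2 * |y i| := fun i => by
      rcases le_total 0 (y i) with h | h
      · rw [max_eq_left h, abs_of_nonneg h]; ring
      · rw [max_eq_right h, abs_of_nonpos h]; ring
    simp only [this, Finset.sum_add_distrib, ← Finset.mul_sum, loss, l1norm]
    field_simp
  rw [← mul_le_mul_iff_right₀ hN', hloss]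
  constructor
  · intro h s
    refine le_trans ?_ h
    calc ∑ i ∈ s, y i ≤ ∑ i ∈ s, max (y i) 0 := Finset.sum_le_sum fun i _ => le_max_left _ _
      _ ≤ ∑ i, max (y i) 0 := Finset.sum_le_sum_of_subset_of_nonneg (Finset.subset_univ _)
          fun i _ _ => le_max_right _ _
  · intro h
    refine le_trans (le_of_eq ?_) (h (Finset.univ.filter fun i => 0 ≤ y i))
    rw [Finset.sum_filter]
    refine Finset.sum_congr rfl fun i _ => ?_
    split_ifs with hi
    · exact max_eq_left hi
    · exact max_eq_right (not_le.1 hi).le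

namespace Problem

variable {m N : ℕ} (P : Problem m N)

/-! ### The effective domain and the set of minimizers -/

/-- The effective domain of `P.f`. -/
def dom : Set (Z m N) := {z | z.fst ∈ P.C ∧ z ∈ P.feas}

/-- The finite value of `P.f` on its effective domain. -/
noncomputable def obj (z : Z m N) : ℝ := loss z.snd + P.eps

theorem f_of_mem {z : Z m N} (hz : z ∈ P.dom) : P.f z = P.obj z := by
  simp [f, indicatorFn, hz.1, hz.2, obj, loss]

theorem f_of_notMem {z : Z m N} (hz : z ∉ P.dom) : P.f z = ⊤ := by
  by_cases h : z.fst ∈ P.C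
  · have h2 : z ∉ P.feas := fun h2 => hz ⟨h, h2⟩
    simp only [f, indicatorFn, h, h2, if_true, if_false, add_zero]
    exact EReal.coe_add_top _
  · simp only [f, indicatorFn, h, if_false]
    rw [EReal.coe_add_top]
    split_ifs <;> simp

theorem mem_solutions {z : Z m N} :
    z ∈ P.solutions ↔ z ∈ P.dom ∧ ∀ z' ∈ P.dom, P.obj z ≤ P.obj z' :=
  mem_argminSet_iff (fun _ => P.f_of_mem) (fun _ => P.f_of_notMem)

theorem mem_T {z v : Z m N} :
    v ∈ P.T z ↔ z ∈ P.dom ∧ ∀ z' ∈ P.dom, P.obj z + inner ℝ v (z' - z) ≤ P.obj z' :=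
  mem_subdiff_iff (fun _ => P.f_of_mem) (fun _ => P.f_of_notMem)

theorem solutions_subset_dom : P.solutions ⊆ P.dom := fun _ hz => (P.mem_solutions.1 hz).1

theorem convexOn_obj : ConvexOn ℝ Set.univ P.obj := by
  refine ⟨convex_univ, fun x _ y _ a b ha hb hab => ?_⟩
  have h := (convexOn_loss (N := N)).2 (Set.mem_univ x.snd) (Set.mem_univ y.snd) ha hb hab
  simp only [obj, smul_eq_mul] at *
  have : (a • x + b • y).snd = a • x.snd + b • y.snd := rfl
  rw [this]
  have h2 : P.eps = (a + b) * P.eps := by rw [hab, one_mul]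
  linarith

theorem continuous_obj : Continuous P.obj := by
  have h : Continuous fun z : Z m N => z.snd := by fun_prop
  exact (continuous_loss.comp h).add continuous_const

theorem convex_C : Convex ℝ P.C := by
  rintro x ⟨hx1, hx2, hx3⟩ y ⟨hy1, hy2, hy3⟩ a b ha hb hab
  refine ⟨?_, fun j => ?_, ?_⟩
  · rw [inner_add_right, real_inner_smul_right, real_inner_smul_right]
    have := mul_le_mul_of_nonneg_left hx1 ha
    have := mul_le_mul_of_nonneg_left hy1 hb
    have : P.rho + P.eps = (a + b) * (P.rho + P.eps) := by rw [hab, one_mul]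
    linarith
  · have := mul_nonneg ha (hx2 j)
    have := mul_nonneg hb (hy2 j)
    simp only [PiLp.add_apply, PiLp.smul_apply, smul_eq_mul]
    linarith
  · simp [Finset.sum_add_distrib, ← Finset.mul_sum, hx3, hy3, hab]

theorem aff_sub (x y : EuclideanSpace ℝ (Fin m)) :
    P.aff x - P.aff y = Matrix.toEuclideanLin P.A (x - y) := by
  simp [aff, map_sub]

theorem aff_combo {a b : ℝ} (hab : a + b = 1) (x y : EuclideanSpace ℝ (Fin m)) :
    P.aff (a • x + b • y) = a • P.aff x + b • P.aff y := by
  simp only [aff, map_add, map_smul, smul_sub]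
  rw [sub_add_sub_comm, ← add_smul, hab, one_smul]

theorem continuous_aff : Continuous P.aff := by
  have : Continuous (Matrix.toEuclideanLin P.A) :=
    (Matrix.toEuclideanLin P.A).continuous_of_finiteDimensional
  unfold aff
  fun_prop

theorem convex_dom : Convex ℝ P.dom := by
  rintro x ⟨hx1, hx2⟩ y ⟨hy1, hy2⟩ a b ha hb hab
  refine ⟨P.convex_C hx1 hy1 ha hb hab, ?_⟩
  have hx2 : x.snd = P.aff x.fst := hx2
  have hy2 : y.snd = P.aff y.fst := hy2
  change a • x.snd + b • y.snd = P.aff (a • x.fst + b • y.fst)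
  rw [hx2, hy2, P.aff_combo hab]

theorem isCompact_C : IsCompact P.C := by
  have hclosed : IsClosed P.C := by
    refine IsClosed.inter ?_ (IsClosed.inter ?_ ?_)
    · exact isClosed_le continuous_const (Continuous.inner (𝕜 := ℝ) continuous_const continuous_id)
    · change IsClosed {x : EuclideanSpace ℝ (Fin m) | ∀ j, 0 ≤ x j}
      rw [Set.ofPred_forall]
      exact isClosed_iInter fun j => isClosed_le continuous_const (by fun_prop)
    · exact isClosed_eq (by fun_prop) continuous_const
  refine Metric.isCompact_of_isClosed_isBounded hclosed
    ((Metric.isBounded_closedBall (x := (0 : EuclideanSpace ℝ (Fin m))) (r := 1)).subset ?_)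
  rintro x ⟨-, hx2, hx3⟩
  rw [mem_closedBall_zero_iff, EuclideanSpace.norm_eq]
  refine Real.sqrt_le_one.2 ?_
  rw [← hx3]
  refine Finset.sum_le_sum fun j _ => ?_
  have h1 : x j ≤ 1 := by
    rw [← hx3]; exact Finset.single_le_sum (fun i _ => hx2 i) (Finset.mem_univ j)
  rw [Real.norm_eq_abs, sq_abs]
  nlinarith [hx2 j]

theorem isCompact_dom : IsCompact P.dom := by
  have h : P.dom = (fun x => pair x (P.aff x)) '' P.C := by
    ext z
    constructor
    · rintro ⟨h1, h2⟩
      exact ⟨z.fst, h1, ext_fst_snd rfl h2.symm⟩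
    · rintro ⟨x, hx, rfl⟩
      exact ⟨hx, rfl⟩
  rw [h]
  refine P.isCompact_C.image ?_
  have := P.continuous_aff
  unfold pair
  fun_prop

theorem isCompact_solutions (hS : P.solutions.Nonempty) : IsCompact P.solutions := by
  obtain ⟨s, hs⟩ := hS
  have h : P.solutions = P.dom ∩ {z | P.obj z ≤ P.obj s} := by
    ext z
    rw [P.mem_solutions]
    refine and_congr_right fun hz => ⟨fun h => h s (P.solutions_subset_dom hs), fun h z' hz' => ?_⟩
    exact le_trans h ((P.mem_solutions.1 hs).2 z' hz')
  rw [h]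
  exact P.isCompact_dom.inter_right (isClosed_le P.continuous_obj continuous_const)

theorem pos_of_mem_C {x : EuclideanSpace ℝ (Fin m)} (hx : x ∈ P.C) : 0 < m := by
  rcases Nat.eq_zero_or_pos m with rfl | h
  · simpa using hx.2.2
  · exact h

/-! ### Weak sharp minima and the error bound for the subdifferential -/

/-- The minimizers of `P.f` are weakly sharp: within the effective domain, the distance to the
solution set is at most a multiple of the optimality gap. The solution set is a polyhedron, cut out
of the effective domain by the `2 ^ N` inequalities of `loss_le_iff`, and a feasible point violates
only these, by at most `N` times its gap; Hoffman's bound applies. -/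
theorem exists_infDist_le_mul_gap (hN : 0 < N) {s : Z m N} (hs : s ∈ P.solutions) :
    ∃ L : ℝ, 0 < L ∧ ∀ z ∈ P.dom, Metric.infDist z P.solutions ≤ L * (P.obj z - P.obj s) := by
  have hN' : (0 : ℝ) < N := by exact_mod_cast hN
  let fstL : Z m N →ₗ[ℝ] EuclideanSpace ℝ (Fin m) := WithLp.fstₗ 2 ℝ _ _
  let sndL : Z m N →ₗ[ℝ] EuclideanSpace ℝ (Fin N) := WithLp.sndₗ 2 ℝ _ _
  let coordX (j : Fin m) : Z m N →ₗ[ℝ] ℝ :=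
    (EuclideanSpace.proj j : EuclideanSpace ℝ (Fin m) →L[ℝ] ℝ).toLinearMap ∘ₗ fstL
  let coordY (i : Fin N) : Z m N →ₗ[ℝ] ℝ :=
    (EuclideanSpace.proj i : EuclideanSpace ℝ (Fin N) →L[ℝ] ℝ).toLinearMap ∘ₗ sndL
  let Λ : Z m N →ₗ[ℝ] ℝ × EuclideanSpace ℝ (Fin N) :=
    (∑ j, coordX j).prod (sndL - Matrix.toEuclideanLin P.A ∘ₗ fstL)
  let c : ℝ × EuclideanSpace ℝ (Fin N) := (1, -(P.eps • ones N))
  let l : Option (Fin m ⊕ Finset (Fin N)) → Z m N →ₗ[ℝ] ℝ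
    | none => -((innerₛₗ ℝ P.mean) ∘ₗ fstL)
    | some (.inl j) => -coordX j
    | some (.inr t) => ∑ i ∈ t, coordY i
  let b : Option (Fin m ⊕ Finset (Fin N)) → ℝ
    | none => -(P.rho + P.eps)
    | some (.inl _) => 0
    | some (.inr _) => N * loss s.snd
  have hdom : ∀ z : Z m N, z ∈ P.dom ↔ (Λ z = c ∧ ∀ i, (i = none ∨ ∃ j, i = some (.inl j)) →
      l i z ≤ b i) := by
    intro z
    have h1 : Λ z = c ↔ ∑ j, z.fst j = 1 ∧ z.snd = P.aff z.fst := by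
      rw [Prod.ext_iff]
      refine and_congr ?_ ?_
      · change (∑ j, coordX j) z = 1 ↔ _
        rw [LinearMap.sum_apply]; rfl
      change z.snd - Matrix.toEuclideanLin P.A z.fst = -(P.eps • ones N) ↔ _
      rw [aff, sub_eq_iff_eq_add, neg_add_eq_sub]
    have h2 : (∀ i, (i = none ∨ ∃ j, i = some (.inl j)) → l i z ≤ b i) ↔
        P.rho + P.eps ≤ inner ℝ P.mean z.fst ∧ ∀ j, 0 ≤ z.fst j := by
      constructor
      · intro h
        refine ⟨neg_le_neg_iff.1 (h none (Or.inl rfl)), fun j => ?_⟩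
        exact neg_nonpos.1 (h (some (.inl j)) (Or.inr ⟨j, rfl⟩))
      · rintro ⟨h, h'⟩ i (rfl | ⟨j, rfl⟩)
        · exact neg_le_neg h
        · exact neg_nonpos.2 (h' j)
    rw [h1, h2]
    change ((_ ∧ _ ∧ _) ∧ _) ↔ _
    constructor
    · rintro ⟨⟨a1, a2, a3⟩, a4⟩; exact ⟨⟨a3, a4⟩, a1, a2⟩
    · rintro ⟨⟨a3, a4⟩, a1, a2⟩; exact ⟨⟨a1, a2, a3⟩, a4⟩
  have hl : ∀ (t : Finset (Fin N)) (z : Z m N), l (some (.inr t)) z = ∑ i ∈ t, z.snd i := by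
    intro t z
    simp only [l, LinearMap.sum_apply]; rfl
  have hsol : P.solutions = {z | Λ z = c ∧ ∀ i, l i z ≤ b i} := by
    ext z
    have h1 : z ∈ P.solutions ↔ z ∈ P.dom ∧ loss z.snd ≤ loss s.snd := by
      rw [P.mem_solutions]
      refine and_congr_right fun hz => ⟨fun h => ?_, fun h z' hz' => ?_⟩
      · exact le_of_add_le_add_right (h s (P.solutions_subset_dom hs))
      · exact le_trans (add_le_add_left h _) ((P.mem_solutions.1 hs).2 z' hz')
    rw [h1, hdom, loss_le_iff hN, Set.mem_ofPred_eq, and_assoc]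
    refine and_congr_right fun _ => ⟨fun h i => ?_, fun h => ⟨fun i _ => h i, fun t => ?_⟩⟩
    · rcases i with _ | j | t
      · exact h.1 _ (Or.inl rfl)
      · exact h.1 _ (Or.inr ⟨j, rfl⟩)
      · rw [hl]; exact h.2 t
    · rw [← hl]; exact h (some (.inr t))
  obtain ⟨L, hL, hoff⟩ := exists_infDist_le_mul_of_violation_le Λ c l b
    (by rw [← hsol]; exact ⟨s, hs⟩)
  refine ⟨L * N, by positivity, fun z hz => ?_⟩
  rw [hsol, mul_assoc]
  have hgap : 0 ≤ P.obj z - P.obj s := sub_nonneg.2 ((P.mem_solutions.1 hs).2 z hz)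
  refine hoff z _ (by positivity) ((hdom z).1 hz).1 fun i => ?_
  have hτ : 0 ≤ N * (P.obj z - P.obj s) := by positivity
  rcases i with _ | j | t
  · exact le_add_of_le_of_nonneg (((hdom z).1 hz).2 _ (Or.inl rfl)) hτ
  · exact le_add_of_le_of_nonneg (((hdom z).1 hz).2 _ (Or.inr ⟨j, rfl⟩)) hτ
  · rw [hl]
    refine ((loss_le_iff hN).1 le_rfl t).trans (le_of_eq ?_)
    change _ = N * loss s.snd + N * (P.obj z - P.obj s)
    simp only [obj]; ring

/-- A global error bound: every subgradient at a point bounds the distance from that point to the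
solution set. Weak sharpness gives `dist ≤ L ‖v‖ dist`, hence `1 ≤ L ‖v‖` off the solution set,
and the effective domain is bounded. -/
theorem exists_infDist_le_mul_norm_subgradient (hN : 0 < N) (hS : P.solutions.Nonempty) :
    ∃ κ : ℝ, 0 < κ ∧ ∀ z, ∀ v ∈ P.T z, Metric.infDist z P.solutions ≤ κ * ‖v‖ := by
  obtain ⟨s, hs⟩ := hS
  obtain ⟨L, hL, hsharp⟩ := P.exists_infDist_le_mul_gap hN hs
  obtain ⟨R, hR0, hR⟩ := P.isCompact_dom.isBounded.exists_pos_norm_le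
  refine ⟨2 * R * L, by positivity, fun z v hv => ?_⟩
  obtain ⟨hz, hsub⟩ := P.mem_T.1 hv
  obtain ⟨q, hq, hqz⟩ := (P.isCompact_solutions ⟨s, hs⟩).exists_infDist_eq_dist ⟨s, hs⟩ z
  have hqd := P.solutions_subset_dom hq
  have h1 : P.obj z - P.obj s ≤ ‖v‖ * dist z q := by
    have h2 := hsub q hqd
    have h3 := (P.mem_solutions.1 hq).2 s (P.solutions_subset_dom hs)
    have h4 := neg_le_of_abs_le (abs_real_inner_le_norm v (q - z))
    rw [dist_comm, dist_eq_norm]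
    linarith
  have h5 := (hsharp z hz).trans (mul_le_mul_of_nonneg_left h1 hL.le)
  rw [hqz] at h5 ⊢
  have h6 : dist z q ≤ 2 * R := by
    rw [dist_eq_norm]
    linarith [norm_sub_le z q, hR z hz, hR q hqd]
  rcases (dist_nonneg (x := z) (y := q)).eq_or_lt with h0 | h0
  · rw [← h0]; positivity
  · have h7 : 1 ≤ L * ‖v‖ := by
      by_contra! h
      nlinarith
    nlinarith [norm_nonneg v]

theorem errorBound_of_forall_subgradient {κ : ℝ} (hκ : 0 < κ)
    (h : ∀ z, ∀ v ∈ P.T z, Metric.infDist z P.solutions ≤ κ * ‖v‖) (r : ℝ) : P.ErrorBound r κ := by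
  intro z _
  rw [mul_comm, ← ENNReal.div_le_iff_le_mul (by simp [hκ]) (by simp)]
  refine Metric.le_infEDist.2 fun v hv => ?_
  rw [ENNReal.div_le_iff_le_mul (by simp [hκ]) (by simp), edist_dist, dist_zero_left,
    ← ENNReal.ofReal_mul (norm_nonneg _), mul_comm]
  exact ENNReal.ofReal_le_ofReal (h z v hv)

/-! ### Optimality conditions -/

theorem zero_mem_T {z : Z m N} (hz : z ∈ P.solutions) : 0 ∈ P.T z := by
  rw [P.mem_T]
  simpa using P.mem_solutions.1 hz

/-- At a minimizer the loss has a subgradient `g` which is nonnegative in the directions of the image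
of `C` under `P.aff`. This is the subdifferential chain and sum rule, obtained by separating the
strict epigraph of the loss from the image of `C` placed at the optimal height. -/
theorem exists_subgradient_loss {z : Z m N} (hz : z ∈ P.solutions) :
    ∃ g : EuclideanSpace ℝ (Fin N), (∀ y, loss z.snd + inner ℝ g (y - z.snd) ≤ loss y) ∧
      ∀ x ∈ P.C, 0 ≤ inner ℝ g (P.aff x - z.snd) := by
  obtain ⟨hzd, hmin⟩ := P.mem_solutions.1 hz
  set y₀ := z.snd
  let A : Set (EuclideanSpace ℝ (Fin N) × ℝ) := {q | q.1 ∈ Set.univ ∧ loss q.1 < q.2}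
  let B : Set (EuclideanSpace ℝ (Fin N) × ℝ) := {q | ∃ x ∈ P.C, q = (P.aff x, loss y₀)}
  have hA : Convex ℝ A := (convexOn_loss (N := N)).convex_strict_epigraph
  have hAo : IsOpen A := by
    have : A = {q | loss q.1 < q.2} := by ext; simp [A]
    rw [this]
    exact isOpen_lt (continuous_loss.comp continuous_fst) continuous_snd
  have hB : Convex ℝ B := by
    rintro _ ⟨x, hx, rfl⟩ _ ⟨x', hx', rfl⟩ a b ha hb hab
    refine ⟨_, P.convex_C hx hx' ha hb hab, ?_⟩
    rw [P.aff_combo hab]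
    ext1
    · simp
    · simp [← add_mul, hab]
  have hAB : Disjoint A B := by
    rw [Set.disjoint_left]
    rintro _ ⟨-, h1⟩ ⟨x, hx, rfl⟩
    have h2 := hmin (pair x (P.aff x)) ⟨hx, rfl⟩
    exact absurd h1 (not_lt.2 (le_of_add_le_add_right h2))
  obtain ⟨φ, u, hφA, hφB⟩ := geometric_hahn_banach_open hA hAo hB hAB
  have hφ : ∀ (y : EuclideanSpace ℝ (Fin N)) (τ : ℝ), φ (y, τ) = φ (y, 0) + τ * φ (0, 1) := by
    intro y τ
    rw [← smul_eq_mul, ← map_smul, ← map_add]; simp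
  have hsubB : ∀ (y y' : EuclideanSpace ℝ (Fin N)), φ (y - y', 0) = φ (y, 0) - φ (y', 0) := by
    intro y y'
    rw [← map_sub]; simp
  set β := φ (0, 1) with hβ
  have hz0 : (y₀, loss y₀) ∈ B := ⟨z.fst, hzd.1, by rw [← show y₀ = P.aff z.fst from hzd.2]⟩
  -- The separating functional is not vertical, because the loss is finite everywhere.
  have hβneg : β < 0 := by
    have h1 := hφA (y₀, loss y₀ + 1) ⟨trivial, by simp⟩
    have h2 := hφB _ hz0
    rw [hφ] at h1 h2
    linarith
  -- Letting the height decrease to the graph turns the strict separation into a weak one.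
  have hle : ∀ y, φ (y, 0) + loss y * β ≤ u := by
    intro y
    by_contra! h
    have h1 := hφA (y, loss y + (φ (y, 0) + loss y * β - u) / (-β))
      ⟨trivial, by
        have : 0 < (φ (y, 0) + loss y * β - u) / (-β) := div_pos (by linarith) (by linarith)
        simpa using this⟩
    rw [hφ, add_mul] at h1
    have h2 : (φ (y, 0) + loss y * β - u) / (-β) * β = -(φ (y, 0) + loss y * β - u) := by
      rw [div_neg, neg_mul, div_mul_cancel₀ _ hβneg.ne]
    linarith
  have hu : u = φ (y₀, 0) + loss y₀ * β := by
    refine le_antisymm ?_ (hle y₀)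
    rw [← hφ]; exact hφB _ hz0
  let ψ : StrongDual ℝ (EuclideanSpace ℝ (Fin N)) :=
    φ.comp (ContinuousLinearMap.inl ℝ (EuclideanSpace ℝ (Fin N)) ℝ)
  let g := (-β)⁻¹ • (InnerProductSpace.toDual ℝ (EuclideanSpace ℝ (Fin N))).symm ψ
  have hg : ∀ y, inner ℝ g y = (-β)⁻¹ * φ (y, 0) := by
    intro y
    rw [real_inner_smul_left, InnerProductSpace.toDual_symm_apply]; rfl
  have hβ' : 0 < (-β)⁻¹ := inv_pos.2 (by linarith)
  have hββ : (-β)⁻¹ * β = -1 := by rw [inv_neg, neg_mul, inv_mul_cancel₀ hβneg.ne]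
  refine ⟨g, fun y => ?_, fun x hx => ?_⟩
  · rw [hg, hsubB]
    have h1 := mul_le_mul_of_nonneg_left ((hle y).trans hu.le) hβ'.le
    have h2 : ∀ w c : ℝ, (-β)⁻¹ * (w + c * β) = (-β)⁻¹ * w - c := fun w c => by
      rw [mul_add, mul_left_comm, hββ]; ring
    rw [h2, h2] at h1
    rw [mul_sub]; linarith
  · rw [hg, hsubB]
    refine mul_nonneg hβ'.le ?_
    have h1 := hφB _ ⟨x, hx, rfl⟩
    rw [hφ, hu] at h1
    linarith

theorem exists_KKT (hN : 0 < N) {z : Z m N} (hz : z ∈ P.solutions) : ∃ u, P.KKT z u := by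
  have hN' : (0 : ℝ) < N := by exact_mod_cast hN
  obtain ⟨g, hg1, hg2⟩ := P.exists_subgradient_loss hz
  obtain ⟨hzC, hzf⟩ := P.solutions_subset_dom hz
  have hzf : z.snd = P.aff z.fst := hzf
  refine ⟨-g, ⟨(2 * (N : ℝ)) • g - ones N, ?_, ?_⟩, ?_, hzf⟩
  · rw [mem_subdiff_iff (D := Set.univ) (h := l1norm) (fun _ _ => rfl)
      (fun _ h => absurd trivial h)]
    refine ⟨trivial, fun y _ => ?_⟩
    have h1 := mul_le_mul_of_nonneg_left (hg1 y) (by positivity : (0 : ℝ) ≤ 2 * N)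
    have h2 : ∀ w : EuclideanSpace ℝ (Fin N), 2 * (N : ℝ) * loss w = ∑ i, w i + l1norm w := by
      intro w; simp only [loss]; field_simp
    have h3 : ∀ w : EuclideanSpace ℝ (Fin N), inner ℝ (ones N) w = ∑ i, w i := by
      intro w; simp [ones, PiLp.inner_apply]
    rw [mul_add, h2, h2] at h1
    rw [inner_sub_left, real_inner_smul_left, h3]
    simp only [PiLp.sub_apply, Finset.sum_sub_distrib]
    linarith
  · rw [smul_sub, smul_smul]
    have : 1 / (2 * (N : ℝ)) * (2 * N) = 1 := by field_simp
    rw [this, one_smul]; abel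
  · rw [mem_subdiff_indicatorFn_iff]
    refine ⟨hzC, fun x hx => ?_⟩
    have h := hg2 x hx
    rw [hzf, P.aff_sub] at h
    have hadj : inner ℝ (Matrix.toEuclideanLin P.A.transpose (-g)) (x - z.fst) =
        inner ℝ (-g) (Matrix.toEuclideanLin P.A (x - z.fst)) := by
      rw [← Matrix.conjTranspose_eq_transpose_of_trivial,
        Matrix.toEuclideanLin_conjTranspose_eq_adjoint, LinearMap.adjoint_inner_left]
    rw [hadj, inner_neg_left]
    linarith

end Problem

/-! ### Generalities on proximal steps and almost monotone sequences -/

/-- First-order optimality for a proximal step, from the one-sided derivative at `p` along the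
segment from the minimizer `p` to `z`. -/
theorem add_inner_div_le_of_forall_prox_le {E F : Type*} [AddCommGroup E] [Module ℝ E]
    [NormedAddCommGroup F] [InnerProductSpace ℝ F] (Φ : E →ₗ[ℝ] F) {D : Set E} {h : E → ℝ}
    (hh : ConvexOn ℝ D h) {σ : ℝ} (hσ : 0 < σ) {c p : E} (hp : p ∈ D)
    (hmin : ∀ z ∈ D, h p + 1 / (2 * σ) * ‖Φ (p - c)‖ ^ 2 ≤ h z + 1 / (2 * σ) * ‖Φ (z - c)‖ ^ 2)
    {z : E} (hz : z ∈ D) : h p + inner ℝ (Φ (c - p)) (Φ (z - p)) / σ ≤ h z := by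
  set I : ℝ := inner ℝ (Φ (c - p)) (Φ (z - p)) with hI
  set W := ‖Φ (z - p)‖ ^ 2
  -- Minimality at the point `p + θ (z - p)` with `θ = 1 / (n + 1)`, divided by `θ`.
  have key : ∀ n : ℕ, h p + I / σ ≤ h z + 1 / ((n : ℝ) + 1) * (W / (2 * σ)) := by
    intro n
    set θ : ℝ := 1 / ((n : ℝ) + 1) with hθ
    have hθ0 : 0 < θ := by positivity
    have hθ1 : θ ≤ 1 := by
      rw [hθ, div_le_one (by positivity)]
      have : (0 : ℝ) ≤ n := by positivity
      linarith
    have h1 := hh.2 hp hz (sub_nonneg.2 hθ1) hθ0.le (by ring)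
    have h2 := hmin _ (hh.1 hp hz (sub_nonneg.2 hθ1) hθ0.le (by ring))
    have h3 : Φ ((1 - θ) • p + θ • z - c) = θ • Φ (z - p) - Φ (c - p) := by
      simp only [map_sub, map_add, map_smul, sub_smul, one_smul, smul_sub]; abel
    have h4 : ‖Φ ((1 - θ) • p + θ • z - c)‖ ^ 2 = θ ^ 2 * W - 2 * (θ * I) + ‖Φ (p - c)‖ ^ 2 := by
      rw [h3, norm_sub_sq_real, norm_smul, real_inner_smul_left, real_inner_comm, ← hI, mul_pow,
        Real.norm_of_nonneg hθ0.le, ← neg_sub p c, map_neg, norm_neg]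
    rw [h4] at h2
    simp only [smul_eq_mul] at h1
    have h5 : θ * (h p + I / σ) ≤ θ * (h z + θ * (W / (2 * σ))) := by
      have h6 : 1 / (2 * σ) * (θ ^ 2 * W - 2 * (θ * I) + ‖Φ (p - c)‖ ^ 2) =
          θ * (θ * (W / (2 * σ))) - θ * (I / σ) + 1 / (2 * σ) * ‖Φ (p - c)‖ ^ 2 := by
        field_simp
      linarith
    exact le_of_mul_le_mul_left h5 hθ0
  have hlim : Tendsto (fun n : ℕ => h z + 1 / ((n : ℝ) + 1) * (W / (2 * σ))) atTop (𝓝 (h z)) := by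
    have := (tendsto_one_div_add_atTop_nhds_zero_nat (𝕜 := ℝ)).mul_const (W / (2 * σ))
    simpa using this.const_add (h z)
  exact ge_of_tendsto' hlim key

/-- A nonnegative sequence that increases by at most summable amounts converges: subtracting the
partial sums of `e` makes it antitone. -/
theorem exists_tendsto_of_le_add_summable {a e : ℕ → ℝ} (ha : ∀ k, 0 ≤ a k) (he : ∀ k, 0 ≤ e k)
    (hsum : Summable e) (h : ∀ k, a (k + 1) ≤ a k + e k) : ∃ l, Tendsto a atTop (𝓝 l) := by
  set b : ℕ → ℝ := fun k => a k - ∑ j ∈ Finset.range k, e j with hb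
  have hanti : Antitone b := antitone_nat_of_succ_le fun k => by
    simp only [hb, Finset.sum_range_succ]
    linarith [h k]
  have hbdd : BddBelow (Set.range b) := ⟨-∑' j, e j, by
    rintro _ ⟨k, rfl⟩
    have := hsum.sum_le_tsum (Finset.range k) fun j _ => he j
    simp only [hb]
    linarith [ha k]⟩
  refine ⟨_, ((tendsto_atTop_ciInf hanti hbdd).add hsum.hasSum.tendsto_sum_nat).congr fun k => ?_⟩
  simp [hb]

/-! ### Comparison of weighted distances and step-size limits -/

theorem wdist_mono {m N : ℕ} {S : Set (Z m N)} (hS : IsCompact S) (hne : S.Nonempty) {s t : ℝ}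
    (hs : 0 ≤ s) (hst : s ≤ t) (z : Z m N) :
    wdist (precond m N s) z S ≤ wdist (precond m N t) z S := by
  obtain ⟨q, hq, h⟩ := exists_wdist_eq hS hne (hs.trans hst) z
  rw [h]
  exact (wdist_le hq z).trans (wnorm_mono hs hst _)

theorem sqrt_min_mul_infDist_le_wdist {m N : ℕ} {S : Set (Z m N)} (hS : IsCompact S)
    (hne : S.Nonempty) {t : ℝ} (ht : 0 ≤ t) (z : Z m N) :
    √(min 1 t) * Metric.infDist z S ≤ wdist (precond m N t) z S := by
  obtain ⟨q, hq, h⟩ := exists_wdist_eq hS hne ht z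
  rw [h]
  refine le_trans ?_ (sqrt_min_mul_norm_le_wnorm ht _)
  rw [← dist_eq_norm]
  exact mul_le_mul_of_nonneg_left (Metric.infDist_le_dist_of_mem hq) (Real.sqrt_nonneg _)

theorem StepSizes.sigma_inf_pos {σ γ : ℕ → ℝ} {σ_inf γ_inf : ℝ} (h : StepSizes σ γ σ_inf γ_inf) :
    0 < σ_inf :=
  (h.sigma_pos 0).trans_le (h.sigma_mono.ge_of_tendsto h.sigma_lim 0)

theorem StepSizes.gamma_inf_pos {σ γ : ℕ → ℝ} {σ_inf γ_inf : ℝ} (h : StepSizes σ γ σ_inf γ_inf) :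
    0 < γ_inf :=
  (h.gamma_pos 0).trans_le (h.gamma_mono.ge_of_tendsto h.gamma_lim 0)

theorem StepSizes.ratio_pos {σ γ : ℕ → ℝ} {σ_inf γ_inf : ℝ} (h : StepSizes σ γ σ_inf γ_inf)
    (k : ℕ) : 0 < σ k / γ k := div_pos (h.sigma_pos k) (h.gamma_pos k)

theorem StepSizes.ratio_lim {σ γ : ℕ → ℝ} {σ_inf γ_inf : ℝ} (h : StepSizes σ γ σ_inf γ_inf) :
    Tendsto (fun k => σ k / γ k) atTop (𝓝 (σ_inf / γ_inf)) :=
  h.sigma_lim.div h.gamma_lim h.gamma_inf_pos.ne'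

theorem StepSizes.ratio_inf_le {σ γ : ℕ → ℝ} {σ_inf γ_inf : ℝ} (h : StepSizes σ γ σ_inf γ_inf)
    (k : ℕ) : σ_inf / γ_inf ≤ σ k / γ k := h.ratio_anti.le_of_tendsto h.ratio_lim k

namespace Problem

variable {m N : ℕ} (P : Problem m N)

/-! ### The exact proximal step -/

theorem center_eq_self {z : Z m N} (hz : z ∈ P.feas) : P.center z = z :=
  ext_fst_snd rfl (show P.aff z.fst = z.snd from Eq.symm hz)

theorem mem_prox {σ γ : ℝ} {zk p : Z m N} :
    p ∈ P.prox σ γ zk ↔ p ∈ P.dom ∧ ∀ z ∈ P.dom,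
      P.obj p + 1 / (2 * σ) * wnorm (precond m N (σ / γ)) (p - P.center zk) ^ 2 ≤
        P.obj z + 1 / (2 * σ) * wnorm (precond m N (σ / γ)) (z - P.center zk) ^ 2 := by
  refine mem_argminSet_iff (g := P.subObj σ γ zk) (D := P.dom) (h := fun z => P.obj z +
    1 / (2 * σ) * wnorm (precond m N (σ / γ)) (z - P.center zk) ^ 2) (fun z hz => ?_)
    (fun z hz => ?_)
  · rw [subObj, P.f_of_mem hz, ← EReal.coe_add]
  · rw [subObj, P.f_of_notMem hz, EReal.top_add_coe]

section Prox

variable {P} {σ γ : ℝ} (hσ : 0 < σ) (hγ : 0 < γ) {zk p : Z m N} (hp : p ∈ P.prox σ γ zk)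

include hσ hγ hp

/-- The optimality condition of the proximal subproblem, as membership in `P.T`. -/
theorem smul_precond_mem_T :
    σ⁻¹ • precond m N (σ / γ) (P.center zk - p) ∈ P.T p := by
  have ht : 0 ≤ σ / γ := (div_pos hσ hγ).le
  obtain ⟨hpd, hmin⟩ := P.mem_prox.1 hp
  simp only [wnorm_precond ht] at hmin
  refine P.mem_T.2 ⟨hpd, fun z hz => ?_⟩
  have h := add_inner_div_le_of_forall_prox_le _
    (P.convexOn_obj.subset (Set.subset_univ _) P.convex_dom) hσ hpd hmin hz
  rw [inner_precond_left, precond_sqrt_sqrt ht, ← inner_precond_left] at h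
  rwa [real_inner_smul_left, mul_comm, ← div_eq_mul_inv]

/-- The three-point inequality: the proximal objective grows quadratically away from its
minimizer. -/
theorem prox_three_point {z : Z m N} (hz : z ∈ P.dom) :
    2 * σ * (P.obj p - P.obj z) + wnorm (precond m N (σ / γ)) (p - P.center zk) ^ 2 +
      wnorm (precond m N (σ / γ)) (p - z) ^ 2 ≤
        wnorm (precond m N (σ / γ)) (P.center zk - z) ^ 2 := by
  have ht : 0 ≤ σ / γ := (div_pos hσ hγ).le
  have h := (P.mem_T.1 (smul_precond_mem_T hσ hγ hp)).2 z hz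
  set c := P.center zk
  rw [real_inner_smul_left, ← precond_sqrt_sqrt ht, inner_precond_left] at h
  rw [wnorm_sub_comm ht p c, wnorm_sub_comm ht p z]
  simp only [wnorm_precond ht]
  have h1 : c - z = (c - p) - (z - p) := by abel
  rw [h1, map_sub _ (c - p) (z - p), norm_sub_sq_real]
  set I : ℝ := inner ℝ (precond m N √(σ / γ) (c - p)) (precond m N √(σ / γ) (z - p))
  have h2 : 2 * σ * (P.obj p + σ⁻¹ * I) ≤ 2 * σ * P.obj z := by gcongr
  have h3 : 2 * σ * (P.obj p + σ⁻¹ * I) = 2 * σ * P.obj p + 2 * I := by field_simp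
  linarith

theorem prox_sq_add_sq_le {s : Z m N} (hs : s ∈ P.solutions) :
    wnorm (precond m N (σ / γ)) (p - P.center zk) ^ 2 + wnorm (precond m N (σ / γ)) (p - s) ^ 2 ≤
        wnorm (precond m N (σ / γ)) (P.center zk - s) ^ 2 := by
  have h := prox_three_point hσ hγ hp (P.solutions_subset_dom hs)
  have h1 := (P.mem_solutions.1 hs).2 p (P.mem_prox.1 hp).1
  have h2 : 0 ≤ 2 * σ * (P.obj p - P.obj s) := mul_nonneg (by positivity) (sub_nonneg.2 h1)
  linarith

theorem wnorm_prox_sub_le {s : Z m N} (hs : s ∈ P.solutions) :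
    wnorm (precond m N (σ / γ)) (p - s) ≤ wnorm (precond m N (σ / γ)) (P.center zk - s) := by
  refine le_of_sq_le_sq ?_ (wnorm_nonneg _ _)
  have := prox_sq_add_sq_le hσ hγ hp hs
  nlinarith [sq_nonneg (wnorm (precond m N (σ / γ)) (p - P.center zk))]

theorem wnorm_prox_sub_center_le (hS : P.solutions.Nonempty) :
    wnorm (precond m N (σ / γ)) (p - P.center zk) ≤
      wdist (precond m N (σ / γ)) (P.center zk) P.solutions := by
  obtain ⟨s, hs, h⟩ := exists_wdist_eq (P.isCompact_solutions hS) hS (div_pos hσ hγ).le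
    (P.center zk)
  rw [h]
  refine le_of_sq_le_sq ?_ (wnorm_nonneg _ _)
  have := prox_sq_add_sq_le hσ hγ hp hs
  nlinarith [sq_nonneg (wnorm (precond m N (σ / γ)) (p - s))]

theorem wdist_le_wdist_center_add (hS : P.solutions.Nonempty) (z : Z m N) :
    wdist (precond m N (σ / γ)) z P.solutions ≤
      wdist (precond m N (σ / γ)) (P.center zk) P.solutions +
        wnorm (precond m N (σ / γ)) (z - p) := by
  have ht : 0 ≤ σ / γ := (div_pos hσ hγ).le
  obtain ⟨s, hs, h⟩ := exists_wdist_eq (P.isCompact_solutions hS) hS ht (P.center zk)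
  rw [h]
  linarith [wdist_le (M := precond m N (σ / γ)) hs z, wnorm_sub_le ht z p s,
    wnorm_prox_sub_le hσ hγ hp hs]

/-- The exact proximal step contracts the weighted distance to the solution set. The error bound at
the subgradient `M (c - p) / σ` gives `dist_M(p) ≤ (κ λ / σ) ‖p - c‖_M`, to be combined with
`‖p - c‖_M² + dist_M(p)² ≤ dist_M(c)²`. -/
theorem wdist_prox_le (hS : P.solutions.Nonempty) {κ : ℝ} (hκ : 0 < κ)
    (herr : ∀ z, ∀ v ∈ P.T z, Metric.infDist z P.solutions ≤ κ * ‖v‖) :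
    wdist (precond m N (σ / γ)) p P.solutions ≤
      κ * max 1 (σ / γ) / √(σ ^ 2 + κ ^ 2 * max 1 (σ / γ) ^ 2) *
        wdist (precond m N (σ / γ)) (P.center zk) P.solutions := by
  have ht : 0 ≤ σ / γ := (div_pos hσ hγ).le
  have hSc := P.isCompact_solutions hS
  obtain ⟨s, hs, hd⟩ := exists_wdist_eq hSc hS ht (P.center zk)
  obtain ⟨q, hq, hpq⟩ := hSc.exists_infDist_eq_dist hS p
  have hlam : 0 < max 1 (σ / γ) := lt_max_of_lt_left one_pos
  set lam := max 1 (σ / γ) with hlamdef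
  set M := precond m N (σ / γ) with hM
  set c := P.center zk
  set a := wdist M p P.solutions
  set b := wnorm M (p - c)
  set d := wdist M c P.solutions
  have ha : 0 ≤ a := wdist_nonneg _ _ _
  have hb : 0 ≤ b := wnorm_nonneg _ _
  have hdn : 0 ≤ d := wdist_nonneg _ _ _
  have h1 : b ^ 2 + a ^ 2 ≤ d ^ 2 := by
    have h := prox_sq_add_sq_le hσ hγ hp hs
    rw [← hM, ← hd] at h
    have : a ^ 2 ≤ wnorm M (p - s) ^ 2 := by
      have := wdist_le (M := M) hs p
      gcongr
    linarith
  have h2 : σ * a ≤ κ * lam * b := by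
    have h3 : a ≤ √lam * Metric.infDist p P.solutions := by
      rw [hpq, dist_eq_norm]
      exact (wdist_le hq p).trans (wnorm_le_sqrt_max ht _)
    have h4 := herr p _ (smul_precond_mem_T hσ hγ hp)
    rw [norm_smul, Real.norm_of_nonneg (inv_nonneg.2 hσ.le)] at h4
    have h5 : ‖M (c - p)‖ ≤ √lam * b := by
      have := norm_precond_le ht (c - p)
      rwa [wnorm_sub_comm ht] at this
    calc σ * a ≤ σ * (√lam * (κ * (σ⁻¹ * (√lam * b)))) := by
          have : σ⁻¹ * ‖M (c - p)‖ ≤ σ⁻¹ * (√lam * b) := by gcongr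
          have : κ * (σ⁻¹ * ‖M (c - p)‖) ≤ κ * (σ⁻¹ * (√lam * b)) := by gcongr
          have : √lam * Metric.infDist p P.solutions ≤ √lam * (κ * (σ⁻¹ * (√lam * b))) :=
            mul_le_mul_of_nonneg_left (h4.trans this) (Real.sqrt_nonneg _)
          exact mul_le_mul_of_nonneg_left (h3.trans this) hσ.le
      _ = κ * (√lam * √lam) * b := by field_simp
      _ = κ * lam * b := by rw [Real.mul_self_sqrt hlam.le]
  have hpos : 0 < σ ^ 2 + κ ^ 2 * lam ^ 2 := by positivity
  rw [div_mul_eq_mul_div, le_div_iff₀ (Real.sqrt_pos.2 hpos)]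
  refine le_of_sq_le_sq ?_ (by positivity)
  rw [mul_pow, Real.sq_sqrt hpos.le]
  have h6 : (σ * a) ^ 2 ≤ (κ * lam * b) ^ 2 := by gcongr
  have h7 : (κ * lam) ^ 2 * (b ^ 2 + a ^ 2) ≤ (κ * lam) ^ 2 * d ^ 2 := by gcongr
  nlinarith

/-- A step with relative error `ζ` contracts the weighted distance by `rateFactor`. Comparing with
the solution `s` nearest to the exact step, `‖z - c‖_M` is at most `‖z - s‖_M` plus `1 + θ` times
the distance of `c`, where `θ` is the contraction factor of the exact step; the term
`ζ ‖z - s‖_M` is then absorbed on the left. -/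
theorem wdist_inexact_le (hS : P.solutions.Nonempty) {κ : ℝ} (hκ : 0 < κ)
    (herr : ∀ z, ∀ v ∈ P.T z, Metric.infDist z P.solutions ≤ κ * ‖v‖) {ζ : ℝ} (hζ0 : 0 ≤ ζ)
    (hζ1 : ζ < 1) {z : Z m N} (hz : wnorm (precond m N (σ / γ)) (z - p) ≤
      ζ * wnorm (precond m N (σ / γ)) (z - P.center zk)) :
    wdist (precond m N (σ / γ)) z P.solutions ≤ rateFactor κ σ ζ (max 1 (σ / γ)) *
        wdist (precond m N (σ / γ)) (P.center zk) P.solutions := by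
  have ht : 0 ≤ σ / γ := (div_pos hσ hγ).le
  have h1 := wdist_prox_le hσ hγ hp hS hκ herr
  have h2 := wnorm_prox_sub_center_le hσ hγ hp hS
  obtain ⟨s, hs, hps⟩ := exists_wdist_eq (P.isCompact_solutions hS) hS ht p
  set θ := κ * max 1 (σ / γ) / √(σ ^ 2 + κ ^ 2 * max 1 (σ / γ) ^ 2) with hθ
  set M := precond m N (σ / γ) with hM
  set d := wdist M (P.center zk) P.solutions
  rw [hps] at h1
  have h3 : wnorm M (z - P.center zk) ≤ wnorm M (z - s) + (θ * d + d) := by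
    have e1 := wnorm_sub_le ht z s (P.center zk)
    have e2 := wnorm_sub_le ht s p (P.center zk)
    rw [wnorm_sub_comm ht s p] at e2
    linarith
  have h4 := wnorm_sub_le ht z p s
  have h5 := mul_le_mul_of_nonneg_left h3 hζ0
  have h6 : rateFactor κ σ ζ (max 1 (σ / γ)) = (ζ + (1 + ζ) * θ) / (1 - ζ) := by
    rw [rateFactor, hθ]; ring
  refine (wdist_le hs z).trans ?_
  rw [h6, div_mul_eq_mul_div, le_div_iff₀ (by linarith)]
  linarith

end Prox

/-! ### Convergence of the inexact iteration -/

/-- Passing to the proximal centre is Lipschitz, uniformly over weights in a bounded range. -/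
theorem exists_wnorm_center_sub_center_le (t₀ : ℝ) :
    ∃ K : ℝ, 0 ≤ K ∧ ∀ t, 0 ≤ t → t ≤ t₀ → ∀ a b : Z m N,
      wnorm (precond m N t) (P.center a - P.center b) ≤ K * wnorm (precond m N t) (a - b) := by
  set B := (Matrix.toEuclideanLin P.A).toContinuousLinearMap
  refine ⟨√(1 + t₀ * ‖B‖ ^ 2), Real.sqrt_nonneg _, fun t ht htt a b => ?_⟩
  refine le_of_sq_le_sq ?_ (mul_nonneg (Real.sqrt_nonneg _) (wnorm_nonneg _ _))
  have ht₀ : 0 ≤ t₀ := ht.trans htt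
  rw [mul_pow, Real.sq_sqrt (by positivity), wnorm_sq ht, wnorm_sq ht]
  have h1 : (P.center a - P.center b).fst = a.fst - b.fst := rfl
  have h2 : (P.center a - P.center b).snd = B (a.fst - b.fst) := P.aff_sub a.fst b.fst
  have h3 : (a - b).fst = a.fst - b.fst := rfl
  rw [h1, h2, h3]
  have h4 : ‖B (a.fst - b.fst)‖ ^ 2 ≤ ‖B‖ ^ 2 * ‖a.fst - b.fst‖ ^ 2 := by
    rw [← mul_pow]
    have := B.le_opNorm (a.fst - b.fst)
    gcongr
  calc ‖a.fst - b.fst‖ ^ 2 + t * ‖B (a.fst - b.fst)‖ ^ 2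
      ≤ ‖a.fst - b.fst‖ ^ 2 + t₀ * (‖B‖ ^ 2 * ‖a.fst - b.fst‖ ^ 2) := by gcongr
    _ = (1 + t₀ * ‖B‖ ^ 2) * ‖a.fst - b.fst‖ ^ 2 := by ring
    _ ≤ _ := by
      gcongr
      exact le_add_of_nonneg_right (by positivity)

/-- The inexact iteration is quasi-Fejér monotone with respect to every solution, and the objective
values of the exact steps tend to the minimum; a cluster point of the exact steps is therefore a
solution, and it attracts the whole sequence. -/
theorem exists_tendsto_of_criterionA (hS : P.solutions.Nonempty) {σ γ ς : ℕ → ℝ}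
    {σ_inf γ_inf : ℝ} {z : ℕ → Z m N} (hst : StepSizes σ γ σ_inf γ_inf) (hς0 : ∀ k, 0 ≤ ς k)
    (hς : Summable ς) (hA : P.CriterionA σ γ ς z) :
    ∃ zstar ∈ P.solutions, Tendsto z atTop (𝓝 zstar) := by
  choose p hp hzp using hA
  set t : ℕ → ℝ := fun k => σ k / γ k with ht
  have ht0 : ∀ k, 0 ≤ t k := fun k => (hst.ratio_pos k).le
  obtain ⟨K, hK0, hK⟩ := P.exists_wnorm_center_sub_center_le (t 0)
  have hpd : ∀ k, p k ∈ P.dom := fun k => (P.mem_prox.1 (hp k)).1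
  have hsum : Summable fun k => K * ς k := hς.mul_left K
  have hKς0 : Tendsto (fun k => K * ς k) atTop (𝓝 0) := hsum.tendsto_atTop_zero
  set w : ℕ → Z m N → ℝ := fun k => wnorm (precond m N (t k)) with hw
  have hquasi : ∀ s ∈ P.solutions, ∀ k,
      w (k + 1) (P.center (z (k + 1)) - s) ≤ w k (p k - s) + K * ς k := by
    intro s hs k
    have h1 : w (k + 1) (P.center (z (k + 1)) - s) ≤ w k (P.center (z (k + 1)) - s) :=
      wnorm_mono (ht0 _) (hst.ratio_anti (Nat.le_succ k)) _
    have h2 := wnorm_sub_le (ht0 k) (P.center (z (k + 1))) (p k) s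
    have h3 := hK (t k) (ht0 k) (hst.ratio_anti (Nat.zero_le k)) (z (k + 1)) (p k)
    rw [P.center_eq_self (hpd k).2] at h3
    have h4 := mul_le_mul_of_nonneg_left (hzp k) hK0
    linarith
  have hfejer : ∀ s ∈ P.solutions, ∀ k, w k (p k - s) ≤ w k (P.center (z k) - s) := fun s hs k =>
    wnorm_prox_sub_le (hst.sigma_pos k) (hst.gamma_pos k) (hp k) hs
  have hlim : ∀ s ∈ P.solutions, ∃ l, Tendsto (fun k => w k (P.center (z k) - s)) atTop (𝓝 l) ∧
      Tendsto (fun k => w k (p k - s)) atTop (𝓝 l) := by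
    intro s hs
    obtain ⟨l, hl⟩ := exists_tendsto_of_le_add_summable
      (a := fun k => w k (P.center (z k) - s)) (fun k => wnorm_nonneg _ _)
      (fun k => mul_nonneg hK0 (hς0 k)) hsum
      (fun k => (hquasi s hs k).trans (add_le_add_left (hfejer s hs k) _))
    -- Squeeze `‖p k - s‖` between the shifted sequence, less the errors, and the sequence itself.
    refine ⟨l, hl, tendsto_of_tendsto_of_tendsto_of_le_of_le
      (g := fun k => w (k + 1) (P.center (z (k + 1)) - s) - K * ς k) ?_ hl
      (fun k => by linarith [hquasi s hs k]) (hfejer s hs)⟩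
    simpa using ((tendsto_add_atTop_iff_nat 1).2 hl).sub hKς0
  have hobj : ∀ s ∈ P.solutions, Tendsto (fun k => P.obj (p k)) atTop (𝓝 (P.obj s)) := by
    intro s hs
    obtain ⟨l, h1, h2⟩ := hlim s hs
    have h3 : Tendsto (fun k => P.obj s +
        (w k (P.center (z k) - s) ^ 2 - w k (p k - s) ^ 2) / (2 * σ 0)) atTop (𝓝 (P.obj s)) := by
      simpa using (((h1.pow 2).sub (h2.pow 2)).div_const (2 * σ 0)).const_add (P.obj s)
    have hgap : ∀ k, P.obj s ≤ P.obj (p k) := fun k => (P.mem_solutions.1 hs).2 _ (hpd k)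
    refine tendsto_of_tendsto_of_tendsto_of_le_of_le tendsto_const_nhds h3 hgap fun k => ?_
    -- The three-point inequality bounds the gap by the decrease of the squared distances.
    have h4 := prox_three_point (hst.sigma_pos k) (hst.gamma_pos k) (hp k)
      (P.solutions_subset_dom hs)
    have h5 : σ 0 * (P.obj (p k) - P.obj s) ≤ σ k * (P.obj (p k) - P.obj s) :=
      mul_le_mul_of_nonneg_right (hst.sigma_mono (Nat.zero_le k)) (sub_nonneg.2 (hgap k))
    have h6 : P.obj (p k) - P.obj s ≤
        (w k (P.center (z k) - s) ^ 2 - w k (p k - s) ^ 2) / (2 * σ 0) := by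
      rw [le_div_iff₀ (by linarith [hst.sigma_pos 0])]
      have h7 := sq_nonneg (wnorm (precond m N (σ k / γ k)) (p k - P.center (z k)))
      simp only [hw, ht]
      linarith
    linarith
  obtain ⟨s₀, hs₀⟩ := hS
  obtain ⟨s, hsd, φ, hφ, hps⟩ := P.isCompact_dom.tendsto_subseq hpd
  have hs : s ∈ P.solutions := by
    have h1 : P.obj s = P.obj s₀ := tendsto_nhds_unique
      ((P.continuous_obj.tendsto s).comp hps) ((hobj s₀ hs₀).comp hφ.tendsto_atTop)
    refine P.mem_solutions.2 ⟨hsd, fun z' hz' => ?_⟩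
    rw [h1]; exact (P.mem_solutions.1 hs₀).2 z' hz'
  refine ⟨s, hs, ?_⟩
  obtain ⟨l, -, hl⟩ := hlim s hs
  have hl0 : l = 0 := by
    refine tendsto_nhds_unique (hl.comp hφ.tendsto_atTop) ?_
    have h1 : Tendsto (fun k => √(max 1 (t 0)) * ‖p (φ k) - s‖) atTop (𝓝 0) := by
      simpa using (tendsto_iff_norm_sub_tendsto_zero.1 hps).const_mul (√(max 1 (t 0)))
    refine squeeze_zero (fun k => wnorm_nonneg _ _) (fun k => ?_) h1
    exact (wnorm_mono (ht0 _) (hst.ratio_anti (Nat.zero_le _)) _).trans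
      (wnorm_le_sqrt_max (ht0 0) _)
  rw [hl0] at hl
  set τ := σ_inf / γ_inf with hτ
  have hτ0 : 0 < τ := div_pos hst.sigma_inf_pos hst.gamma_inf_pos
  have hmin : 0 < √(min 1 τ) := Real.sqrt_pos.2 (lt_min one_pos hτ0)
  rw [← tendsto_add_atTop_iff_nat 1, tendsto_iff_norm_sub_tendsto_zero]
  have h1 : Tendsto (fun k => (ς k + w k (p k - s)) / √(min 1 τ)) atTop (𝓝 0) := by
    simpa using (hς.tendsto_atTop_zero.add hl).div_const (√(min 1 τ))
  refine squeeze_zero (fun k => norm_nonneg _) (fun k => ?_) h1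
  rw [le_div_iff₀ hmin, mul_comm]
  calc √(min 1 τ) * ‖z (k + 1) - s‖ ≤ wnorm (precond m N τ) (z (k + 1) - s) :=
        sqrt_min_mul_norm_le_wnorm hτ0.le _
    _ ≤ w k (z (k + 1) - s) := wnorm_mono hτ0.le (hst.ratio_inf_le k) _
    _ ≤ w k (z (k + 1) - p k) + w k (p k - s) := wnorm_sub_le (ht0 k) _ _ _
    _ ≤ ς k + w k (p k - s) := add_le_add_left (hzp k) _

end Problem

/-! ### The limit of the rate and the convergence theorem -/

theorem tendsto_rateFactor {σ ζ lam : ℕ → ℝ} {σ_inf lam_inf : ℝ} (κ : ℝ) (hσ : 0 < σ_inf)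
    (hσl : Tendsto σ atTop (𝓝 σ_inf)) (hζ : Tendsto ζ atTop (𝓝 0))
    (hlam : Tendsto lam atTop (𝓝 lam_inf)) :
    Tendsto (fun k => rateFactor κ (σ k) (ζ k) (lam k)) atTop
      (𝓝 (κ * lam_inf / √(σ_inf ^ 2 + κ ^ 2 * lam_inf ^ 2))) := by
  have hpos : 0 < σ_inf ^ 2 + κ ^ 2 * lam_inf ^ 2 := by positivity
  have h1 : Tendsto (fun k => 1 / (1 - ζ k)) atTop (𝓝 (1 / (1 - 0))) :=
    tendsto_const_nhds.div (tendsto_const_nhds.sub hζ) (by norm_num)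
  have h2 : Tendsto (fun k => √(σ k ^ 2 + κ ^ 2 * lam k ^ 2)) atTop
      (𝓝 (√(σ_inf ^ 2 + κ ^ 2 * lam_inf ^ 2))) :=
    (Real.continuous_sqrt.tendsto _).comp ((hσl.pow 2).add ((hlam.pow 2).const_mul _))
  have h3 : Tendsto (fun k => (1 + ζ k) * κ * lam k) atTop (𝓝 ((1 + 0) * κ * lam_inf)) :=
    ((tendsto_const_nhds.add hζ).mul_const κ).mul hlam
  have h4 := h1.mul (hζ.add (h3.div h2 (Real.sqrt_pos.2 hpos).ne'))
  simpa [rateFactor] using h4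

theorem mul_div_sqrt_lt_one {κ σ lam : ℝ} (hσ : 0 < σ) :
    κ * lam / √(σ ^ 2 + κ ^ 2 * lam ^ 2) < 1 := by
  have hpos : 0 < σ ^ 2 + κ ^ 2 * lam ^ 2 := by positivity
  rw [div_lt_one (Real.sqrt_pos.2 hpos)]
  refine Real.lt_sqrt_of_sq_lt ?_
  rw [mul_pow]
  linarith [pow_pos hσ 2]

end DRMLSAD

theorem theorem4p1 {m N : ℕ} (hN : 0 < N) (P : DRMLSAD.Problem m N)
    (hS : P.solutions.Nonempty) :
    -- Part (1)
    (∀ (σ γ ς : ℕ → ℝ) (σ_inf γ_inf : ℝ) (z : ℕ → DRMLSAD.Z m N),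
      DRMLSAD.StepSizes σ γ σ_inf γ_inf → (∀ k, 0 ≤ ς k) → Summable ς →
      P.CriterionA σ γ ς z →
        Bornology.IsBounded (Set.range z) ∧
        (∀ k, z k ∈ P.feas →
          DRMLSAD.wdist (DRMLSAD.precond m N (σ (k + 1) / γ (k + 1))) (z (k + 1)) P.solutions ≤
            DRMLSAD.wdist (DRMLSAD.precond m N (σ k / γ k)) (z k) P.solutions + ς k) ∧
        ∃ zstar ∈ P.solutions, Tendsto z atTop (𝓝 zstar) ∧ 0 ∈ P.T zstar ∧
          ∃ u, P.KKT zstar u) ∧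
    -- Part (2)
    (∀ r : ℝ, ∃ κ : ℝ, 0 < κ ∧ P.ErrorBound r κ ∧
      ∀ (σ γ ς ζ : ℕ → ℝ) (σ_inf γ_inf : ℝ) (z : ℕ → DRMLSAD.Z m N),
        DRMLSAD.StepSizes σ γ σ_inf γ_inf → (∀ k, 0 ≤ ς k) → Summable ς →
        (∀ k, 0 ≤ ζ k) → Summable ζ →
        P.CriterionA σ γ ς z → P.CriterionB σ γ ζ z →
        (∀ k, z k ∈ P.feas) →
        r = (∑' k, ς k) +
          DRMLSAD.wdist (DRMLSAD.precond m N (σ 0 / γ 0)) (z 0) P.solutions →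
        ∀ (M : ℕ → (DRMLSAD.Z m N →ₗ[ℝ] DRMLSAD.Z m N)) (mu : ℕ → ℝ) (lam_inf : ℝ),
          (∀ k, M k = DRMLSAD.precond m N (σ k / γ k)) →
          (∀ k, mu k = DRMLSAD.rateFactor κ (σ k) (ζ k) (DRMLSAD.lambdaMax (M k))) →
          lam_inf = limsup (fun k => DRMLSAD.lambdaMax (M k)) atTop →
            (∀ k, ζ k < 1 →
              DRMLSAD.wdist (M (k + 1)) (z (k + 1)) P.solutions ≤
                mu k * DRMLSAD.wdist (M k) (z k) P.solutions) ∧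
            limsup mu atTop = κ * lam_inf / √(σ_inf ^ 2 + κ ^ 2 * lam_inf ^ 2) ∧
            κ * lam_inf / √(σ_inf ^ 2 + κ ^ 2 * lam_inf ^ 2) < 1 ∧
            (∀ k, ζ k < 1 →
              Metric.infDist (z (k + 1)) P.solutions ≤
                mu k / √(DRMLSAD.lambdaMin (M (k + 1))) *
                  DRMLSAD.wdist (M k) (z k) P.solutions)) := by
  have hSc := P.isCompact_solutions hS
  have hm : 0 < m := by
    obtain ⟨s, hs⟩ := hS
    exact P.pos_of_mem_C (P.solutions_subset_dom hs).1
  refine ⟨fun σ γ ς σ_inf γ_inf z hst hς0 hς hA => ?_, fun r => ?_⟩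
  · obtain ⟨zstar, hzs, hlim⟩ := P.exists_tendsto_of_criterionA hS hst hς0 hς hA
    refine ⟨Metric.isBounded_range_of_tendsto z hlim, fun k hk => ?_, zstar, hzs, hlim,
      P.zero_mem_T hzs, P.exists_KKT hN hzs⟩
    obtain ⟨p, hp, hzp⟩ := hA k
    have h1 := DRMLSAD.wdist_mono hSc hS (hst.ratio_pos (k + 1)).le
      (hst.ratio_anti (Nat.le_succ k)) (z (k + 1))
    have h2 := DRMLSAD.Problem.wdist_le_wdist_center_add (hst.sigma_pos k) (hst.gamma_pos k) hp hS
      (z (k + 1))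
    rw [P.center_eq_self hk] at h2
    linarith
  · -- The effective domain is bounded, so one constant serves every radius `r`.
    obtain ⟨κ, hκ, herr⟩ := P.exists_infDist_le_mul_norm_subgradient hN hS
    refine ⟨κ, hκ, P.errorBound_of_forall_subgradient hκ herr r, ?_⟩
    intro σ γ ς ζ σ_inf γ_inf z hst _ _ hζ0 hζ _ hB hfeas _ M mu lam_inf hM hmu hlam
    have hlamk : ∀ k, DRMLSAD.lambdaMax (M k) = max 1 (σ k / γ k) := fun k => by
      rw [hM, DRMLSAD.lambdaMax_precond hm hN]
    have hlamt : Tendsto (fun k => DRMLSAD.lambdaMax (M k)) atTop (𝓝 lam_inf) := by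
      have h : Tendsto (fun k => DRMLSAD.lambdaMax (M k)) atTop (𝓝 (max 1 (σ_inf / γ_inf))) := by
        simp only [hlamk]
        exact tendsto_const_nhds.max hst.ratio_lim
      rwa [hlam, h.limsup_eq]
    have hrate : ∀ k, ζ k < 1 → DRMLSAD.wdist (M (k + 1)) (z (k + 1)) P.solutions ≤
        mu k * DRMLSAD.wdist (M k) (z k) P.solutions := by
      intro k hk
      obtain ⟨p, hp, hzp⟩ := hB k
      have h1 := DRMLSAD.wdist_mono hSc hS (hst.ratio_pos (k + 1)).le
        (hst.ratio_anti (Nat.le_succ k)) (z (k + 1))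
      have h2 := DRMLSAD.Problem.wdist_inexact_le (hst.sigma_pos k) (hst.gamma_pos k) hp hS hκ herr
        (hζ0 k) hk hzp
      rw [P.center_eq_self (hfeas k)] at h2
      rw [hmu, hlamk, hM, hM]
      exact h1.trans h2
    refine ⟨hrate, ?_, DRMLSAD.mul_div_sqrt_lt_one hst.sigma_inf_pos, fun k hk => ?_⟩
    · have h := DRMLSAD.tendsto_rateFactor κ hst.sigma_inf_pos hst.sigma_lim hζ.tendsto_atTop_zero
        hlamt
      simp only [← hmu] at h
      exact h.limsup_eq
    · have h1 := hrate k hk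
      have hpos := hst.ratio_pos (k + 1)
      have h2 := DRMLSAD.sqrt_min_mul_infDist_le_wdist hSc hS hpos.le (z (k + 1))
      rw [← hM] at h2
      rw [hM (k + 1), DRMLSAD.lambdaMin_precond hm hN, div_mul_eq_mul_div,
        le_div_iff₀ (Real.sqrt_pos.2 (lt_min one_pos hpos)), mul_comm]
      exact h2.trans h1
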